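/- Let $\Sigma$ be a finite alphabet. For $k\ge 1$, a two-way $k$-head nondeterministic finite automaton has a finite state set $Q$ with an initial, an accept and a reject state and a transition function $\delta\colon Q\times(\Sigma\sqcup\{\rhd,\lhd\})^k\to\mathcal P(Q\times\{\text{left},\text{stay},\text{right}\}^k)$. On input $x\in\Sigma^*$ it runs on the read-only tape $\rhd x\lhd$ with all $k$ heads initially on $\rhd$; a head that attempts to move beyond an end marker stays on it. A computational path halts when it reaches the accept or the reject state or when $\delta$ offers no further step, and $x$ is accepted if some path reaches the accept state. The automaton runs in linear time if every computational path on every input of length $n$ has at most $O(n)$ steps. For functions $f,g$, let $\mathrm{NTISP}(f(n),g(n))$ be the class of languages recognized by a nondeterministic Turing machine with a two-way read-only input tape (with end markers) and one read/write work tape, such that on every computational path on every input of length $n$ the same machine makes $O(f(n))$ steps and scans $O(g(n))$ work tape cells. Theorem. For every $k\ge 1$, every language $L\subseteq\Sigma^*$ that is recognized by a two-way $k$-head nondeterministic finite automaton running in linear time belongs to $$\mathrm{NTISP}\!\left(\frac{n^2}{\log n},\ \log n\right).$$ -/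

import Mathlib

/-- `ReachesIn step t c d`: some sequence of exactly `t` steps leads from `c` to `d`. -/
inductive ReachesIn {C : Type} (step : C → C → Prop) : ℕ → C → C → Prop
  | refl (c : C) : ReachesIn step 0 c c
  | tail {t : ℕ} {c d e : C} : ReachesIn step t c d → step d e → ReachesIn step (t + 1) c e

/-- The symbols of a read-only input tape: the two end markers and the input letters. -/
inductive InputSymbol (α : Type) : Type
  | leftEnd : InputSymbol α
  | rightEnd : InputSymbol α
  | letter : α → InputSymbol α

/-- The contents of cell `i` of the tape `▷ x ◁`: cell `0` holds `▷`, the cells `1, …, |x|` hold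
the letters of `x`, and cell `|x| + 1` holds `◁`. -/
def inputCell {α : Type} (x : List α) : ℕ → InputSymbol α
  | 0 => .leftEnd
  | i + 1 => match x[i]? with
    | some a => .letter a
    | none => .rightEnd

/-- Head movements: left, stay put, right. -/
inductive HeadMove : Type
  | left : HeadMove
  | stay : HeadMove
  | right : HeadMove

/-- The new position of a head at position `i` of the tape `▷ x ◁` with `|x| = n`. A head that
attempts to move beyond an end marker stays on it. -/
def HeadMove.onInput (n : ℕ) : HeadMove → ℕ → ℕ
  | .left, i => i - 1
  | .stay, i => i
  | .right, i => min (i + 1) (n + 1)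

/-- The new position of a head at cell `i` of a one-way infinite tape with cells `0, 1, 2, …`.
A head that attempts to move left from cell `0` stays there. -/
def HeadMove.onWork : HeadMove → ℕ → ℕ
  | .left, i => i - 1
  | .stay, i => i
  | .right, i => i + 1

/-! ### Two-way multi-head nondeterministic finite automata -/

/-- A two-way nondeterministic finite automaton with `k` heads over the input alphabet `α`. -/
structure TwoNFA (k : ℕ) (α : Type) where
  Q : Type
  finite_Q : Finite Q
  δ : Q → (Fin k → InputSymbol α) → Set (Q × (Fin k → HeadMove))
  q₀ : Q
  qacc : Q
  qrej : Q

namespace TwoNFA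

variable {k : ℕ} {α : Type}

/-- A configuration: the state and the head positions. -/
structure Cfg (M : TwoNFA k α) where
  state : M.Q
  pos : Fin k → ℕ

/-- The initial configuration. -/
def init (M : TwoNFA k α) : M.Cfg := ⟨M.q₀, fun _ => 0⟩

/-- One step on input `x`. No step leaves the accept state or the reject state. -/
def Step (M : TwoNFA k α) (x : List α) (c d : M.Cfg) : Prop :=
  c.state ≠ M.qacc ∧ c.state ≠ M.qrej ∧
    ∃ m : Fin k → HeadMove,
      (d.state, m) ∈ M.δ c.state (fun i => inputCell x (c.pos i)) ∧
        d.pos = fun i => (m i).onInput x.length (c.pos i)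

/-- `M` accepts `x` if some computational path on `x` reaches the accept state. -/
def Accepts (M : TwoNFA k α) (x : List α) : Prop :=
  ∃ t c, ReachesIn (M.Step x) t M.init c ∧ c.state = M.qacc

/-- The language recognized by `M`. -/
def language (M : TwoNFA k α) : Language α := {x | M.Accepts x}

/-- Every computational path on every input `x` has at most `T |x|` steps. -/
def RunsInTime (M : TwoNFA k α) (T : ℕ → ℕ) : Prop :=
  ∀ (x : List α) (t : ℕ) (c : M.Cfg), ReachesIn (M.Step x) t M.init c → t ≤ T x.length

end TwoNFA

/-- The languages over `α` that are recognized by a two-way nondeterministic finite automaton with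
`k` heads which runs for `O(f(n))` steps on every computational path on any input of length `n`. -/
def TwoNFATime (α : Type) (k : ℕ) (f : ℕ → ℝ) : Set (Language α) :=
  {L | ∃ (M : TwoNFA k α) (T : ℕ → ℕ),
    M.language = L ∧ M.RunsInTime T ∧
      Asymptotics.IsBigO Filter.atTop (fun n => (T n : ℝ)) f}

/-- The same with any positive number of heads. -/
def MultiheadNFATime (α : Type) (f : ℕ → ℝ) : Set (Language α) :=
  {L | ∃ k : ℕ, 0 < k ∧ L ∈ TwoNFATime α k f}

/-! ### Nondeterministic Turing machines with a read-only input tape -/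

/-- A nondeterministic Turing machine over the input alphabet `α`, with a two-way read-only input
tape (with end markers) and one read/write work tape with alphabet `Γ`. -/
structure NTM (α : Type) where
  Q : Type
  finite_Q : Finite Q
  Γ : Type
  finite_Γ : Finite Γ
  blank : Γ
  /-- Maps the state and the symbols under the input head and under the work head to the set of
  alternatives: new state, symbol written on the work tape, input head move, work head move. -/
  δ : Q → InputSymbol α → Γ → Set (Q × Γ × HeadMove × HeadMove)
  q₀ : Q
  qacc : Q
  qrej : Q
  qacc_ne_qrej : qacc ≠ qrej

namespace NTM

variable {α : Type}

/-- A configuration: the state, the two head positions and the contents of the work tape. -/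
structure Cfg (N : NTM α) where
  state : N.Q
  inPos : ℕ
  workPos : ℕ
  work : ℕ → N.Γ

/-- The initial configuration: the input head is on the left end marker, and the work head is on
the leftmost cell of a blank work tape. -/
def init (N : NTM α) : N.Cfg := ⟨N.q₀, 0, 0, fun _ => N.blank⟩

/-- One step on input `x`. No step leaves the accept state or the reject state. -/
def Step (N : NTM α) (x : List α) (c d : N.Cfg) : Prop :=
  c.state ≠ N.qacc ∧ c.state ≠ N.qrej ∧
    ∃ (b : N.Γ) (m₁ m₂ : HeadMove),
      (d.state, b, m₁, m₂) ∈ N.δ c.state (inputCell x c.inPos) (c.work c.workPos) ∧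
        d.inPos = m₁.onInput x.length c.inPos ∧
        d.workPos = m₂.onWork c.workPos ∧
        d.work = Function.update c.work c.workPos b

/-- `N` accepts `x` if some computational path on `x` reaches the accept state. -/
def Accepts (N : NTM α) (x : List α) : Prop :=
  ∃ t c, ReachesIn (N.Step x) t N.init c ∧ c.state = N.qacc

/-- The language recognized by `N`. -/
def language (N : NTM α) : Language α := {x | N.Accepts x}

/-- Every computational path on every input `x` has at most `T |x|` steps. -/
def RunsInTime (N : NTM α) (T : ℕ → ℕ) : Prop :=
  ∀ (x : List α) (t : ℕ) (c : N.Cfg), ReachesIn (N.Step x) t N.init c → t ≤ T x.length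

/-- Every computational path on every input `x` scans at most `S |x|` work tape cells. As the work
head starts on cell `0` and moves by at most one cell in a step, the cells that it scans on a path
form an initial segment of the tape, so this says that it never leaves the first `S |x|` cells. -/
def RunsInSpace (N : NTM α) (S : ℕ → ℕ) : Prop :=
  ∀ (x : List α) (t : ℕ) (c : N.Cfg),
    ReachesIn (N.Step x) t N.init c → c.workPos < S x.length

end NTM

/-- The languages over `α` that are recognized by a nondeterministic Turing machine which uses, on
every computational path on any input of length `n`, time `O(f(n))` and space `O(g(n))`
simultaneously. -/
def NTISP (α : Type) (f g : ℕ → ℝ) : Set (Language α) :=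
  {L | ∃ (N : NTM α) (T S : ℕ → ℕ),
    N.language = L ∧ N.RunsInTime T ∧ N.RunsInSpace S ∧
      Asymptotics.IsBigO Filter.atTop (fun n => (T n : ℝ)) f ∧
      Asymptotics.IsBigO Filter.atTop (fun n => (S n : ℝ)) g}


/-!
The machine simulates the automaton in blocks of `b = Θ(log n)` steps. At the start of a block it
guesses `b` records, one per work tape cell, each holding the symbol that every head reads in one
step and the move that the head makes, and checks that the finite control can run on these guesses.
It then verifies the heads one after the other: the only input head walks from the left end marker
to the position of the head at the start of the block, replays the recorded moves while comparing
the recorded symbols with the input, and walks back to the left end marker, counting the new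
position. This takes `O(n)` steps per block, and a run of `T` steps has about `T / b` blocks.

A counter for the walk whose update costs `O(log n)` steps per input cell would spoil the bound.
Therefore a position is stored as a quotient by `b` in binary and a remainder in unary: a single
sweep over the `b` work cells moves the input head by `b` cells and changes the quotient by one.
-/

namespace ReachesIn

variable {C : Type} {step : C → C → Prop}

theorem single {c d : C} (h : step c d) : ReachesIn step 1 c d := .tail (.refl c) h

theorem exists_iff_reflTransGen {c d : C} :
    (∃ t, ReachesIn step t c d) ↔ Relation.ReflTransGen step c d := by
  constructor
  · rintro ⟨t, h⟩
    induction h with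
    | refl => exact .refl
    | tail _ hs ih => exact ih.tail hs
  · intro h
    induction h with
    | refl => exact ⟨0, .refl c⟩
    | tail _ hs ih => exact ⟨_, .tail ih.choose_spec hs⟩

theorem trans {s t : ℕ} {c d e : C} (h₁ : ReachesIn step s c d) (h₂ : ReachesIn step t d e) :
    ReachesIn step (s + t) c e := by
  induction h₂ with
  | refl => exact h₁
  | tail _ hs ih => exact .tail (ih h₁) hs

theorem split {s t : ℕ} {c e : C} (h : ReachesIn step (s + t) c e) :
    ∃ d, ReachesIn step s c d ∧ ReachesIn step t d e := by
  induction t generalizing e with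
  | zero => exact ⟨e, h, .refl e⟩
  | succ t ih =>
    cases h with
    | tail h hs =>
      obtain ⟨d, h₁, h₂⟩ := ih h
      exact ⟨d, h₁, .tail h₂ hs⟩

theorem succ_iff {t : ℕ} {c e : C} :
    ReachesIn step (t + 1) c e ↔ ∃ d, step c d ∧ ReachesIn step t d e := by
  constructor
  · rw [Nat.add_comm]
    intro h
    obtain ⟨d, h₁, h₂⟩ := h.split
    cases h₁ with
    | tail h hs => cases h; exact ⟨d, hs, h₂⟩
  · rintro ⟨d, hs, h⟩
    exact Nat.add_comm 1 t ▸ (single hs).trans h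

theorem invariant {I : ℕ → C → Prop} {t : ℕ} {c d : C} (h : ReachesIn step t c d) (h₀ : I 0 c)
    (h_step : ∀ s d e, I s d → step d e → I (s + 1) e) : I t d := by
  induction h with
  | refl => exact h₀
  | tail _ hs ih => exact h_step _ _ _ (ih h₀) hs

end ReachesIn

theorem inputCell_eq_leftEnd_iff {α : Type} {x : List α} {p : ℕ} :
    inputCell x p = .leftEnd ↔ p = 0 := by
  cases p with
  | zero => simp [inputCell]
  | succ p => simp only [inputCell]; split <;> simp

theorem inputCell_eq_rightEnd_iff {α : Type} {x : List α} {p : ℕ} :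
    inputCell x p = .rightEnd ↔ x.length < p := by
  cases p with
  | zero => simp [inputCell]
  | succ p =>
    simp only [inputCell, Nat.lt_succ_iff, ← List.getElem?_eq_none_iff]
    split <;> simp_all only [reduceCtorEq]

theorem inputCell_ne_rightEnd_iff {α : Type} {x : List α} {p : ℕ} :
    inputCell x p ≠ .rightEnd ↔ p ≤ x.length := by
  rw [Ne, inputCell_eq_rightEnd_iff, not_lt]

theorem InputSymbol.finite (α : Type) [Finite α] : Finite (InputSymbol α) :=
  Finite.of_surjective (Sum.elim .letter fun b : Bool => if b then .leftEnd else .rightEnd) <| by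
    rintro (_ | _ | a)
    exacts [⟨.inr true, rfl⟩, ⟨.inr false, rfl⟩, ⟨.inl a, rfl⟩]

namespace HeadMove

theorem finite : Finite HeadMove :=
  Finite.of_surjective ![.left, .stay, .right] <| by
    rintro (_ | _ | _)
    exacts [⟨0, rfl⟩, ⟨1, rfl⟩, ⟨2, rfl⟩]

theorem onInput_left (n p : ℕ) : HeadMove.left.onInput n p = p - 1 := rfl

theorem onInput_stay (n p : ℕ) : HeadMove.stay.onInput n p = p := rfl

theorem onInput_right {n p : ℕ} (h : p ≤ n) : HeadMove.right.onInput n p = p + 1 :=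
  min_eq_left (Nat.succ_le_succ h)

theorem onInput_le {n p : ℕ} (mv : HeadMove) (h : p ≤ n + 1) : mv.onInput n p ≤ n + 1 := by
  cases mv
  · exact (Nat.sub_le p 1).trans h
  · exact h
  · exact min_le_right _ _

end HeadMove

/-! ### Sweeping machines -/

/-- A machine that acts on the word on its work tape in sweeps from left to right. In a sweep it
rewrites the word as a nondeterministic transducer which also controls the input head, and may
append one cell at the end. -/
structure Sweeper (α : Type) where
  /-- The states between two sweeps. -/
  Q : Type
  finite_Q : Finite Q
  /-- The states during a sweep. -/
  A : Type
  finite_A : Finite A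
  /-- The contents of a cell. -/
  D : Type
  finite_D : Finite D
  Start : Q → InputSymbol α → A → HeadMove → Prop
  Rewrite : A → InputSymbol α → D → A → D → HeadMove → Prop
  Finish : A → InputSymbol α → Q → Option D → Prop
  q₀ : Q
  qacc : Q
  q₀_ne_qacc : q₀ ≠ qacc

namespace Sweeper

variable {α : Type} (S : Sweeper α) (x : List α)

/-- A configuration between two sweeps. -/
structure Cfg where
  state : S.Q
  inPos : ℕ
  word : List S.D

/-- The initial configuration: the word is empty. -/
def init : S.Cfg := ⟨S.q₀, 0, []⟩

/-- The effect of the transducer on a word, from the sweep state `a` and the input head position `p`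
to the sweep state `a'` and the position `p'`. -/
inductive Sweep : S.A → ℕ → List S.D → S.A → ℕ → List S.D → Prop
  | nil (a : S.A) (p : ℕ) : Sweep a p [] a p []
  | cons {a a₁ a' : S.A} {p p' : ℕ} {d d' : S.D} {w w' : List S.D} {mv : HeadMove} :
      S.Rewrite a (inputCell x p) d a₁ d' mv → Sweep a₁ (mv.onInput x.length p) w a' p' w' →
      Sweep a p (d :: w) a' p' (d' :: w')

/-- One sweep together with its start and its finish. -/
def Step (c d : S.Cfg) : Prop :=
  c.state ≠ S.qacc ∧ ∃ a mv a' w' o, S.Start c.state (inputCell x c.inPos) a mv ∧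
    S.Sweep x a (mv.onInput x.length c.inPos) c.word a' d.inPos w' ∧
    S.Finish a' (inputCell x d.inPos) d.state o ∧ d.word = w' ++ o.toList

/-- `S` accepts `x` if some computational path on `x` reaches the accept state. -/
def Accepts : Prop := ∃ m c, ReachesIn (S.Step x) m S.init c ∧ c.state = S.qacc

variable {S x}

theorem Sweep.length_eq {a a' : S.A} {p p' : ℕ} {w w' : List S.D} (h : S.Sweep x a p w a' p' w') :
    w'.length = w.length := by
  induction h with
  | nil => rfl
  | cons _ _ ih => simp only [List.length_cons, ih]

theorem sweep_nil_iff {a a' : S.A} {p p' : ℕ} {w' : List S.D} :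
    S.Sweep x a p [] a' p' w' ↔ a' = a ∧ p' = p ∧ w' = [] := by
  constructor
  · rintro ⟨⟩; exact ⟨rfl, rfl, rfl⟩
  · rintro ⟨rfl, rfl, rfl⟩; exact .nil _ _

theorem sweep_cons_iff {a a' : S.A} {p p' : ℕ} {d : S.D} {w w' : List S.D} :
    S.Sweep x a p (d :: w) a' p' w' ↔ ∃ a₁ d' mv v, S.Rewrite a (inputCell x p) d a₁ d' mv ∧
      S.Sweep x a₁ (mv.onInput x.length p) w a' p' v ∧ w' = d' :: v := by
  constructor
  · rintro (_ | ⟨hr, hs⟩); exact ⟨_, _, _, _, hr, hs, rfl⟩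
  · rintro ⟨a₁, d', mv, v, hr, hs, rfl⟩; exact .cons hr hs

theorem Sweep.snoc {a a₁ a' : S.A} {p p₁ : ℕ} {w w' : List S.D} {d d' : S.D} {mv : HeadMove}
    (h : S.Sweep x a p w a₁ p₁ w') (hr : S.Rewrite a₁ (inputCell x p₁) d a' d' mv) :
    S.Sweep x a p (w ++ [d]) a' (mv.onInput x.length p₁) (w' ++ [d']) := by
  induction h with
  | nil => exact .cons hr (.nil _ _)
  | cons h₁ _ ih => exact .cons h₁ (ih hr)

theorem Step.length_le {c d : S.Cfg} (h : S.Step x c d) : c.word.length ≤ d.word.length := by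
  obtain ⟨-, a, mv, a', w', o, -, hsw, -, hw⟩ := h
  rw [hw, List.length_append, hsw.length_eq]
  exact Nat.le_add_right _ _

/-! ### The Turing machine of a sweeping machine -/

/-- The work tape symbols of the Turing machine of a sweeping machine. -/
inductive Symbol (D : Type) : Type
  | blank : Symbol D
  | marker : Symbol D
  | cell : D → Symbol D

/-- The states of the Turing machine of a sweeping machine. The work head returns to the left end
in a state `returning q`, and the state `rejecting` is never reached. -/
inductive State (Q A : Type) : Type
  | returning : Q → State Q A
  | sweeping : A → State Q A
  | rejecting : State Q A

theorem Symbol.finite (D : Type) [Finite D] : Finite (Symbol D) :=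
  Finite.of_surjective (Sum.elim .cell fun b : Bool => if b then .blank else .marker) <| by
    rintro (_ | _ | d)
    exacts [⟨.inr true, rfl⟩, ⟨.inr false, rfl⟩, ⟨.inl d, rfl⟩]

theorem State.finite (Q A : Type) [Finite Q] [Finite A] : Finite (State Q A) :=
  Finite.of_surjective (Sum.elim .returning (Sum.elim .sweeping fun _ : Unit => .rejecting)) <| by
    rintro (q | a | _)
    exacts [⟨.inl q, rfl⟩, ⟨.inr (.inl a), rfl⟩, ⟨.inr (.inr ()), rfl⟩]

variable (S)

/-- The transitions of the Turing machine of a sweeping machine. A blank symbol under a returning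
head occurs only at the very beginning, when the left end of the work tape is not yet marked. -/
inductive Trans : State S.Q S.A → InputSymbol α → Symbol S.D →
    State S.Q S.A → Symbol S.D → HeadMove → HeadMove → Prop
  | mark (q s) : Trans (.returning q) s .blank (.returning q) .marker .stay .stay
  | back (q s d) : Trans (.returning q) s (.cell d) (.returning q) (.cell d) .stay .left
  | start {q s a mv} : S.Start q s a mv →
      Trans (.returning q) s .marker (.sweeping a) .marker mv .right
  | rewrite {a s d a' d' mv} : S.Rewrite a s d a' d' mv →
      Trans (.sweeping a) s (.cell d) (.sweeping a') (.cell d') mv .right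
  | finish {a s q o} : S.Finish a s q o →
      Trans (.sweeping a) s .blank (.returning q) (o.elim .blank .cell) .stay .left

/-- The Turing machine of a sweeping machine. -/
def toNTM : NTM α where
  Q := State S.Q S.A
  finite_Q := haveI := S.finite_Q; haveI := S.finite_A; State.finite _ _
  Γ := Symbol S.D
  finite_Γ := haveI := S.finite_D; Symbol.finite _
  blank := .blank
  δ := fun q s g => {r | S.Trans q s g r.1 r.2.1 r.2.2.1 r.2.2.2}
  q₀ := .returning S.q₀
  qacc := .returning S.qacc
  qrej := .rejecting
  qacc_ne_qrej := nofun

variable {S}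

/-- The work tape that holds the word `w` to the right of the left marker. -/
def tape {D : Type} (w : List D) : ℕ → Symbol D
  | 0 => .marker
  | j + 1 => (w[j]?).elim .blank .cell

theorem tape_succ_of_lt {D : Type} {w : List D} {j : ℕ} (h : j < w.length) :
    tape w (j + 1) = .cell w[j] := by
  simp [tape, h]

theorem tape_append_cons {D : Type} (u v : List D) (d : D) :
    tape (u ++ d :: v) (u.length + 1) = .cell d := by
  simp [tape]

theorem tape_length_succ {D : Type} (w : List D) : tape w (w.length + 1) = .blank := by
  simp [tape]

theorem update_tape {D : Type} (u v : List D) (d : D) :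
    Function.update (tape (u ++ v)) (u.length + 1) (.cell d) = tape (u ++ d :: v.tail) := by
  funext j
  cases j with
  | zero => rfl
  | succ j =>
    rcases lt_trichotomy j u.length with hj | rfl | hj
    · rw [Function.update_of_ne (by omega)]
      simp [tape, List.getElem?_append_left hj]
    · rw [Function.update_self, tape_append_cons]
    · obtain ⟨i, rfl⟩ := Nat.exists_eq_add_of_lt hj
      rw [Function.update_of_ne (by omega)]
      simp [tape, List.getElem?_append_right, add_assoc]

theorem update_tape_length_succ {D : Type} (w : List D) (o : Option D) :
    Function.update (tape w) (w.length + 1) (o.elim .blank .cell) = tape (w ++ o.toList) := by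
  cases o with
  | none => simpa using (tape_length_succ w).symm
  | some d => simpa using update_tape w [] d

/-- The configuration of the Turing machine with work tape `tape w`. -/
def cfg (q : State S.Q S.A) (p h : ℕ) (w : List S.D) : S.toNTM.Cfg := ⟨q, p, h, tape w⟩

theorem toNTM_step_iff {c e : S.toNTM.Cfg} :
    S.toNTM.Step x c e ↔ c.state ≠ .returning S.qacc ∧ c.state ≠ .rejecting ∧
      ∃ q' b m₁ m₂, S.Trans c.state (inputCell x c.inPos) (c.work c.workPos) q' b m₁ m₂ ∧
        e = ⟨q', m₁.onInput x.length c.inPos, m₂.onWork c.workPos,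
          Function.update c.work c.workPos b⟩ := by
  obtain ⟨q', p', h', f⟩ := e
  constructor
  · rintro ⟨hacc, hrej, b, m₁, m₂, ht, rfl, rfl, rfl⟩
    exact ⟨hacc, hrej, q', b, m₁, m₂, ht, rfl⟩
  · rintro ⟨hacc, hrej, q', b, m₁, m₂, ht, ⟨⟩⟩
    exact ⟨hacc, hrej, b, m₁, m₂, ht, rfl, rfl, rfl⟩

theorem toNTM_step_cfg_iff {q : State S.Q S.A} {p h : ℕ} {w : List S.D} {g : Symbol S.D}
    {e : S.toNTM.Cfg} (hg : tape w h = g) :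
    S.toNTM.Step x (cfg q p h w) e ↔ q ≠ .returning S.qacc ∧ q ≠ .rejecting ∧
      ∃ q' b m₁ m₂, S.Trans q (inputCell x p) g q' b m₁ m₂ ∧
        e = ⟨q', m₁.onInput x.length p, m₂.onWork h, Function.update (tape w) h b⟩ :=
  hg ▸ toNTM_step_iff

theorem toNTM_step_init_iff {e : S.toNTM.Cfg} :
    S.toNTM.Step x S.toNTM.init e ↔ e = cfg (.returning S.q₀) 0 0 [] := by
  have h_tape : Function.update (fun _ => Symbol.blank) 0 .marker = tape ([] : List S.D) := by
    funext j
    cases j <;> rfl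
  rw [toNTM_step_iff]
  constructor
  · rintro ⟨-, -, q', b, m₁, m₂, ht, rfl⟩
    change S.Trans (.returning S.q₀) _ .blank _ _ _ _ at ht
    cases ht
    exact congrArg (NTM.Cfg.mk _ _ _) h_tape
  · rintro rfl
    exact ⟨fun h => S.q₀_ne_qacc (State.returning.inj h), nofun, _, _, _, _, .mark _ _,
      congrArg (NTM.Cfg.mk _ _ _) h_tape.symm⟩

theorem toNTM_step_returning_zero_iff {q : S.Q} {p : ℕ} {w : List S.D} {e : S.toNTM.Cfg} :
    S.toNTM.Step x (cfg (.returning q) p 0 w) e ↔ q ≠ S.qacc ∧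
      ∃ a mv, S.Start q (inputCell x p) a mv ∧
        e = cfg (.sweeping a) (mv.onInput x.length p) 1 w := by
  have h_tape : Function.update (tape w) 0 .marker = tape w := Function.update_eq_self 0 _
  rw [toNTM_step_cfg_iff rfl]
  constructor
  · rintro ⟨hq, -, q', b, m₁, m₂, ⟨⟩ | ⟨⟩ | hs, rfl⟩
    exact ⟨fun h => hq (congrArg _ h), _, _, hs, congrArg (NTM.Cfg.mk _ _ _) h_tape⟩
  · rintro ⟨hq, a, mv, hs, rfl⟩
    exact ⟨fun h => hq (State.returning.inj h), nofun, _, _, _, _, .start hs,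
      congrArg (NTM.Cfg.mk _ _ _) h_tape.symm⟩

theorem toNTM_step_returning_succ_iff {q : S.Q} {p h : ℕ} {w : List S.D} {e : S.toNTM.Cfg}
    (hq : q ≠ S.qacc) (hh : h < w.length) :
    S.toNTM.Step x (cfg (.returning q) p (h + 1) w) e ↔ e = cfg (.returning q) p h w := by
  have h_tape : Function.update (tape w) (h + 1) (.cell w[h]) = tape w :=
    Function.update_eq_self_iff.2 (tape_succ_of_lt hh).symm
  rw [toNTM_step_cfg_iff (tape_succ_of_lt hh)]
  constructor
  · rintro ⟨-, -, q', b, m₁, m₂, ⟨⟩, rfl⟩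
    exact congrArg (NTM.Cfg.mk _ _ _) h_tape
  · rintro rfl
    exact ⟨fun h => hq (State.returning.inj h), nofun, _, _, _, _, .back _ _ _,
      congrArg (NTM.Cfg.mk _ _ _) h_tape.symm⟩

theorem toNTM_step_sweeping_iff {a : S.A} {p : ℕ} {u v : List S.D} {d : S.D} {e : S.toNTM.Cfg} :
    S.toNTM.Step x (cfg (.sweeping a) p (u.length + 1) (u ++ d :: v)) e ↔
      ∃ a' d' mv, S.Rewrite a (inputCell x p) d a' d' mv ∧
        e = cfg (.sweeping a') (mv.onInput x.length p) (u.length + 2) (u ++ d' :: v) := by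
  rw [toNTM_step_cfg_iff (tape_append_cons u v d)]
  constructor
  · rintro ⟨-, -, q', b, m₁, m₂, ⟨⟩ | ⟨⟩ | ⟨⟩ | hr, rfl⟩
    exact ⟨_, _, _, hr, congrArg (NTM.Cfg.mk _ _ _) (update_tape u (d :: v) _)⟩
  · rintro ⟨a', d', mv, hr, rfl⟩
    exact ⟨nofun, nofun, _, _, _, _, .rewrite hr,
      congrArg (NTM.Cfg.mk _ _ _) (update_tape u (d :: v) d').symm⟩

theorem toNTM_step_sweeping_end_iff {a : S.A} {p : ℕ} {w : List S.D} {e : S.toNTM.Cfg} :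
    S.toNTM.Step x (cfg (.sweeping a) p (w.length + 1) w) e ↔
      ∃ q o, S.Finish a (inputCell x p) q o ∧
        e = cfg (.returning q) p w.length (w ++ o.toList) := by
  rw [toNTM_step_cfg_iff (tape_length_succ w)]
  constructor
  · rintro ⟨-, -, q', b, m₁, m₂, ⟨⟩ | ⟨⟩ | ⟨⟩ | ⟨⟩ | hf, rfl⟩
    exact ⟨_, _, hf, congrArg (NTM.Cfg.mk _ _ _) (update_tape_length_succ w _)⟩
  · rintro ⟨q, o, hf, rfl⟩
    exact ⟨nofun, nofun, _, _, _, _, .finish hf,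
      congrArg (NTM.Cfg.mk _ _ _) (update_tape_length_succ w o).symm⟩

theorem reaches_returning {q : S.Q} (hq : q ≠ S.qacc) (p : ℕ) (w : List S.D) {h : ℕ}
    (hh : h ≤ w.length) :
    Relation.ReflTransGen (S.toNTM.Step x) (cfg (.returning q) p h w)
      (cfg (.returning q) p 0 w) := by
  induction h with
  | zero => exact .refl
  | succ h ih =>
    exact .head ((toNTM_step_returning_succ_iff hq hh).2 rfl) (ih (Nat.le_of_succ_le hh))

theorem Sweep.reaches {a a' : S.A} {p p' : ℕ} {v v' : List S.D} (h : S.Sweep x a p v a' p' v')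
    (u : List S.D) :
    Relation.ReflTransGen (S.toNTM.Step x) (cfg (.sweeping a) p (u.length + 1) (u ++ v))
      (cfg (.sweeping a') p' ((u ++ v').length + 1) (u ++ v')) := by
  induction h generalizing u with
  | nil => rw [List.append_nil]
  | @cons a a₁ a' p p' d d' w w' mv hr _ ih =>
    have h_tail := ih (u ++ [d'])
    simp only [List.append_assoc, List.singleton_append, List.length_append,
      List.length_singleton] at h_tail
    simpa using .head (toNTM_step_sweeping_iff.2 ⟨a₁, d', mv, hr, rfl⟩) h_tail

theorem Step.reaches {c d : S.Cfg} (h : S.Step x c d) :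
    Relation.ReflTransGen (S.toNTM.Step x) (cfg (.returning c.state) c.inPos 0 c.word)
      (cfg (.returning d.state) d.inPos c.word.length d.word) := by
  obtain ⟨hne, a, mv, a', w', o, h_start, h_sweep, h_finish, hw⟩ := h
  have h_last : S.toNTM.Step x (cfg (.sweeping a') d.inPos (w'.length + 1) w')
      (cfg (.returning d.state) d.inPos c.word.length d.word) :=
    toNTM_step_sweeping_end_iff.2 ⟨_, o, h_finish, by rw [hw, h_sweep.length_eq]⟩
  exact .head (toNTM_step_returning_zero_iff.2 ⟨hne, a, mv, h_start, rfl⟩)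
    (.tail (h_sweep.reaches []) h_last)

theorem exists_reaches_cfg {m : ℕ} {c : S.Cfg} (h : ReachesIn (S.Step x) m S.init c) :
    ∃ h ≤ c.word.length, Relation.ReflTransGen (S.toNTM.Step x) S.toNTM.init
      (cfg (.returning c.state) c.inPos h c.word) := by
  generalize hc₀ : S.init = c₀ at h
  induction h with
  | refl => exact hc₀ ▸ ⟨0, le_rfl, .single (toNTM_step_init_iff.2 rfl)⟩
  | tail _ hs ih =>
    obtain ⟨h, hh, h_init⟩ := ih hc₀
    exact ⟨_, hs.length_le, (h_init.trans (reaches_returning hs.1 _ _ hh)).trans hs.reaches⟩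

/-- What the Turing machine may be doing after `t` steps. -/
inductive Tracks (S : Sweeper α) (x : List α) : ℕ → S.toNTM.Cfg → Prop
  | init : Tracks S x 0 S.toNTM.init
  | returning {t m h : ℕ} {c : S.Cfg} : ReachesIn (S.Step x) m S.init c → h ≤ c.word.length →
      t + h ≤ m * (2 * c.word.length + 2) + 1 →
      Tracks S x t (cfg (.returning c.state) c.inPos h c.word)
  | sweeping {t m p : ℕ} {c : S.Cfg} {a a' : S.A} {mv : HeadMove} {u u' v : List S.D} :
      ReachesIn (S.Step x) m S.init c → c.state ≠ S.qacc →
      S.Start c.state (inputCell x c.inPos) a mv →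
      S.Sweep x a (mv.onInput x.length c.inPos) u a' p u' → c.word = u ++ v →
      t ≤ m * (2 * c.word.length + 2) + u.length + 2 →
      Tracks S x t (cfg (.sweeping a') p (u'.length + 1) (u' ++ v))

theorem Tracks.step_of_returning {t m h : ℕ} {c : S.Cfg} {e : S.toNTM.Cfg}
    (hc : ReachesIn (S.Step x) m S.init c) (hh : h ≤ c.word.length)
    (ht : t + h ≤ m * (2 * c.word.length + 2) + 1)
    (hs : S.toNTM.Step x (cfg (.returning c.state) c.inPos h c.word) e) :
    Tracks S x (t + 1) e := by
  cases h with
  | zero =>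
    obtain ⟨hne, a, mv, h_start, rfl⟩ := toNTM_step_returning_zero_iff.1 hs
    exact .sweeping hc hne h_start (.nil _ _) rfl (by simpa using ht)
  | succ h =>
    have hne : c.state ≠ S.qacc := fun h => hs.1 (congrArg State.returning h)
    rw [(toNTM_step_returning_succ_iff hne hh).1 hs]
    exact .returning hc (Nat.le_of_succ_le hh) (by omega)

theorem Tracks.step_of_sweeping {t m p : ℕ} {c : S.Cfg} {a a' : S.A} {mv : HeadMove}
    {u u' v : List S.D} {e : S.toNTM.Cfg} (hc : ReachesIn (S.Step x) m S.init c)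
    (hne : c.state ≠ S.qacc) (h_start : S.Start c.state (inputCell x c.inPos) a mv)
    (h_sweep : S.Sweep x a (mv.onInput x.length c.inPos) u a' p u') (hw : c.word = u ++ v)
    (ht : t ≤ m * (2 * c.word.length + 2) + u.length + 2)
    (hs : S.toNTM.Step x (cfg (.sweeping a') p (u'.length + 1) (u' ++ v)) e) :
    Tracks S x (t + 1) e := by
  cases v with
  | cons d v =>
    obtain ⟨a₁, d', mv', hr, rfl⟩ := toNTM_step_sweeping_iff.1 hs
    simpa using Tracks.sweeping hc hne h_start (h_sweep.snoc hr) (v := v) (by simpa using hw)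
      (t := t + 1) (by simp only [List.length_append, List.length_singleton]; omega)
  | nil =>
    rw [List.append_nil] at hs hw
    subst hw
    obtain ⟨q, o, hf, rfl⟩ := toNTM_step_sweeping_end_iff.1 hs
    have h_step : S.Step x c ⟨q, p, u' ++ o.toList⟩ :=
      ⟨hne, a, mv, a', u', o, h_start, h_sweep, hf, rfl⟩
    have h_len := h_sweep.length_eq
    have h_mono : (m + 1) * (2 * c.word.length + 2) ≤ (m + 1) * (2 * (u' ++ o.toList).length + 2) :=
      Nat.mul_le_mul_left _ (by have := h_step.length_le; dsimp only at this; omega)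
    refine .returning (hc.tail h_step) h_step.length_le ?_ |> (h_len ▸ ·)
    dsimp only
    linarith

theorem Tracks.step {t : ℕ} {c d : S.toNTM.Cfg} (h : Tracks S x t c) (hs : S.toNTM.Step x c d) :
    Tracks S x (t + 1) d := by
  cases h with
  | init =>
    rw [toNTM_step_init_iff.1 hs]
    exact .returning (.refl S.init) le_rfl (by simp)
  | returning hc hh ht => exact step_of_returning hc hh ht hs
  | sweeping hc hne h_start h_sweep hw ht => exact step_of_sweeping hc hne h_start h_sweep hw ht hs

theorem tracks_of_reaches {t : ℕ} {c : S.toNTM.Cfg}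
    (h : ReachesIn (S.toNTM.Step x) t S.toNTM.init c) : Tracks S x t c :=
  h.invariant .init fun _ _ _ => Tracks.step

theorem toNTM_accepts_iff : S.toNTM.Accepts x ↔ S.Accepts x := by
  constructor
  · rintro ⟨t, c, hc, hq⟩
    cases tracks_of_reaches hc with
    | init => exact absurd (State.returning.inj hq) S.q₀_ne_qacc
    | returning hm => exact ⟨_, _, hm, State.returning.inj hq⟩
    | sweeping => exact absurd hq nofun
  · rintro ⟨m, c, hc, hq⟩
    obtain ⟨h, -, h_reaches⟩ := exists_reaches_cfg hc
    obtain ⟨t, ht⟩ := ReachesIn.exists_iff_reflTransGen.2 h_reaches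
    exact ⟨t, _, ht, congrArg State.returning hq⟩

theorem runsInSpace_toNTM {L : ℕ → ℕ}
    (hL : ∀ x m c, ReachesIn (S.Step x) m S.init c → c.word.length ≤ L x.length) :
    S.toNTM.RunsInSpace fun n => L n + 2 := by
  intro x t c h
  cases tracks_of_reaches h with
  | init => exact Nat.zero_lt_succ _
  | returning hm hh =>
    have := hL x _ _ hm
    dsimp only [cfg]
    omega
  | @sweeping _ _ _ c _ _ _ u _ _ hm _ _ h_sweep hw =>
    have := hL x _ _ hm
    have hu : u.length ≤ c.word.length := hw ▸ by simp
    have h_len := h_sweep.length_eq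
    dsimp only [cfg]
    omega

theorem runsInTime_toNTM {N L : ℕ → ℕ}
    (hN : ∀ x m c, ReachesIn (S.Step x) m S.init c → m ≤ N x.length)
    (hL : ∀ x m c, ReachesIn (S.Step x) m S.init c → c.word.length ≤ L x.length) :
    S.toNTM.RunsInTime fun n => (N n + 1) * (2 * L n + 2) + 1 := by
  intro x t c h
  have h_mul {m : ℕ} {c : S.Cfg} (hm : ReachesIn (S.Step x) m S.init c) :
      m * (2 * c.word.length + 2) ≤ N x.length * (2 * L x.length + 2) :=
    Nat.mul_le_mul (hN x m c hm) (by have := hL x m c hm; omega)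
  dsimp only
  rw [Nat.succ_mul]
  cases tracks_of_reaches h with
  | init => exact Nat.zero_le _
  | returning hm _ ht =>
    have := h_mul hm
    omega
  | @sweeping _ _ _ c _ _ _ u _ _ hm _ _ _ hw ht =>
    have := hL x _ _ hm
    have hu : u.length ≤ c.word.length := hw ▸ by simp
    have := h_mul hm
    omega

end Sweeper

/-! ### Words that encode head positions and guessed steps -/

/-- The value of a binary number, least significant bit first. -/
def bitVal (l : List Bool) : ℕ := Nat.ofDigits 2 (l.map Bool.toNat)

theorem bitVal_cons (b : Bool) (l : List Bool) : bitVal (b :: l) = b.toNat + 2 * bitVal l := by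
  simp [bitVal, Nat.ofDigits_cons]

theorem bitVal_append (l₁ l₂ : List Bool) :
    bitVal (l₁ ++ l₂) = bitVal l₁ + 2 ^ l₁.length * bitVal l₂ := by
  simp [bitVal, Nat.ofDigits_append]

theorem bitVal_lt (l : List Bool) : bitVal l < 2 ^ l.length := by
  have h_digits : ∀ b ∈ l.map Bool.toNat, b < 2 := List.forall_mem_map.2 fun b _ => b.toNat_lt
  simpa [bitVal] using Nat.ofDigits_lt_base_pow_length one_lt_two h_digits

/-- Adding the carry `c` to the bit `b` gives the bit `b'` and the carry `c'`. -/
def AddCarry (c b c' b' : Bool) : Prop := c.toNat + b.toNat = b'.toNat + 2 * c'.toNat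

theorem AddCarry.exists_add (c b : Bool) : ∃ c' b', AddCarry c b c' b' := by
  cases c <;> cases b <;> simp [AddCarry]

theorem AddCarry.exists_sub (c b' : Bool) : ∃ c' b, AddCarry c b c' b' := by
  cases c <;> cases b' <;> simp [AddCarry]

namespace TwoNFA

/-- What the `k` heads of an automaton read and how they move in one step. -/
abbrev Record (k : ℕ) (α : Type) : Type := Fin k → InputSymbol α × HeadMove

/-- The content of a work tape cell: a bit of the counter for the input length, a bit and a mark of
every head, and the record of one step or, after the automaton has accepted, no record. -/
structure Cell (k : ℕ) (α : Type) where
  countBit : Bool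
  headBits : Fin k → Bool × Bool
  record : Option (Record k α)

theorem Cell.finite (k : ℕ) (α : Type) [Finite α] : Finite (Cell k α) := by
  have := InputSymbol.finite α
  have := HeadMove.finite
  exact Finite.of_surjective
    (fun d : Bool × (Fin k → Bool × Bool) × Option (Record k α) => ⟨d.1, d.2.1, d.2.2⟩)
    fun d => ⟨(d.countBit, d.headBits, d.record), rfl⟩

section Words

variable {k : ℕ} {α : Type}

/-- The counter for the input length. -/
def counter (w : List (Cell k α)) : ℕ := bitVal (w.map Cell.countBit)

/-- The part of a word that encodes the position of head `i`. -/
def track (i : Fin k) (w : List (Cell k α)) : List (Bool × Bool) := w.map fun d => d.headBits i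

/-- The records of a block of steps. -/
def records (w : List (Cell k α)) : List (Option (Record k α)) := w.map Cell.record

/-- The bits of head `i` form the quotient of its position by the length of the word. -/
def headQuot (i : Fin k) (w : List (Cell k α)) : ℕ := bitVal ((track i w).map Prod.fst)

/-- The number of marks of head `i` is the remainder of its position, where the length of the word
itself is also allowed as a remainder. -/
def headRem (i : Fin k) (w : List (Cell k α)) : ℕ := (track i w).countP Prod.snd

/-- The position of head `i` that a word encodes. -/
def headPos (i : Fin k) (w : List (Cell k α)) : ℕ := headQuot i w * w.length + headRem i w

theorem counter_cons (d : Cell k α) (w : List (Cell k α)) :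
    counter (d :: w) = d.countBit.toNat + 2 * counter w := bitVal_cons _ _

theorem headQuot_cons (i : Fin k) (d : Cell k α) (w : List (Cell k α)) :
    headQuot i (d :: w) = (d.headBits i).1.toNat + 2 * headQuot i w := bitVal_cons _ _

theorem headRem_cons (i : Fin k) (d : Cell k α) (w : List (Cell k α)) :
    headRem i (d :: w) = headRem i w + (d.headBits i).2.toNat := by
  simp only [headRem, track, List.map_cons, List.countP_cons, Bool.toNat, Bool.cond_eq_ite]

theorem headQuot_lt (i : Fin k) (w : List (Cell k α)) : headQuot i w < 2 ^ w.length := by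
  simpa [headQuot, track] using bitVal_lt ((track i w).map Prod.fst)

theorem counter_lt (w : List (Cell k α)) : counter w < 2 ^ w.length := by
  simpa [counter] using bitVal_lt (w.map Cell.countBit)

theorem counter_concat (w : List (Cell k α)) (d : Cell k α) :
    counter (w ++ [d]) = counter w + 2 ^ w.length * d.countBit.toNat := by
  have h_bit : bitVal [d.countBit] = d.countBit.toNat := by simp [bitVal]
  rw [counter, List.map_append, bitVal_append, List.length_map, List.map_singleton, h_bit, counter]

theorem headPos_congr {i : Fin k} {w w' : List (Cell k α)} (h : track i w' = track i w) :
    headPos i w' = headPos i w := by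
  have h_len : w'.length = w.length := by simpa [track] using congrArg List.length h
  simp only [headPos, headQuot, headRem, h, h_len]

/-- The words have the same records and encode the positions of the heads `j ≠ i` alike. -/
def SameOff (i : Fin k) (w w' : List (Cell k α)) : Prop :=
  records w' = records w ∧ ∀ j, j ≠ i → track j w' = track j w

namespace SameOff

variable {i : Fin k} {w w' w'' : List (Cell k α)}

theorem refl (i : Fin k) (w : List (Cell k α)) : SameOff i w w := ⟨rfl, fun _ _ => rfl⟩

theorem cons (h : SameOff i w w') (d : Cell k α) (v : Bool × Bool) :
    SameOff i (d :: w) (⟨d.countBit, Function.update d.headBits i v, d.record⟩ :: w') := by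
  refine ⟨congrArg (d.record :: ·) h.1, fun j hj => ?_⟩
  simpa [track, Function.update_of_ne hj] using h.2 j hj

theorem trans (h : SameOff i w w') (h' : SameOff i w' w'') : SameOff i w w'' :=
  ⟨h'.1.trans h.1, fun j hj => (h'.2 j hj).trans (h.2 j hj)⟩

theorem headPos_eq {j : Fin k} (h : SameOff i w w') (hj : j ≠ i) : headPos j w' = headPos j w :=
  headPos_congr (h.2 j hj)

end SameOff

end Words

/-! ### The simulating machine -/

variable {k : ℕ} {α : Type} (M : TwoNFA k α)

/-- The states of the simulation between two sweeps. In the states `next i q`, `seek i q`,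
`verify i q` and `back i q` the guessed records of a block, which leads to the state `q`, have
been verified for the heads before `i`. -/
inductive Control : Type
  | setup : Control
  | rewind : Control
  | main : M.Q → Control
  | next : Fin (k + 1) → M.Q → Control
  | seek : Fin k → M.Q → Control
  | verify : Fin k → M.Q → Control
  | back : Fin k → M.Q → Control
  | acc : Control

/-- The states of the simulation during a sweep. The Boolean is the carry or the borrow. -/
inductive Task : Type
  | count : Bool → Task
  | idle : M.Control → Task
  | guess : M.Q → Task
  | seek : Fin k → Bool → M.Q → Task
  | seekMarks : Fin k → M.Q → Task
  | verify : Fin k → M.Q → Task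
  | back : Fin k → Bool → M.Q → Task
  | backMarks : Fin k → M.Q → Task

theorem Control.finite : Finite M.Control := by
  have := M.finite_Q
  refine Finite.of_injective
    (fun s : M.Control => match s with
      | .setup => (Sum.inl 0 : Fin 3 ⊕ M.Q ⊕ Fin (k + 1) × M.Q ⊕ Fin 3 × Fin k × M.Q)
      | .rewind => .inl 1
      | .acc => .inl 2
      | .main q => .inr (.inl q)
      | .next i q => .inr (.inr (.inl (i, q)))
      | .seek i q => .inr (.inr (.inr (0, i, q)))
      | .verify i q => .inr (.inr (.inr (1, i, q)))
      | .back i q => .inr (.inr (.inr (2, i, q)))) fun a b => ?_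
  cases a <;> cases b <;> simp

theorem Task.finite : Finite M.Task := by
  have := M.finite_Q
  have := Control.finite M
  refine Finite.of_injective
    (fun s : M.Task => match s with
      | .count c => (Sum.inl c :
          Bool ⊕ M.Control ⊕ M.Q ⊕ Bool × Fin k × Bool × M.Q ⊕ Fin 3 × Fin k × M.Q)
      | .idle r => .inr (.inl r)
      | .guess q => .inr (.inr (.inl q))
      | .seek i c q => .inr (.inr (.inr (.inl (true, i, c, q))))
      | .back i c q => .inr (.inr (.inr (.inl (false, i, c, q))))
      | .seekMarks i q => .inr (.inr (.inr (.inr (0, i, q))))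
      | .verify i q => .inr (.inr (.inr (.inr (1, i, q))))
      | .backMarks i q => .inr (.inr (.inr (.inr (2, i, q))))) fun a b => ?_
  cases a <;> cases b <;> simp

/-- How the sweeps of the simulation start. -/
inductive SimStart : M.Control → InputSymbol α → M.Task → HeadMove → Prop
  | count {s} : s ≠ .rightEnd → SimStart .setup s (.count true) .right
  | counted : SimStart .setup .rightEnd (.idle .rewind) .stay
  | rewind {s} : s ≠ .leftEnd → SimStart .rewind s (.idle .rewind) .left
  | rewound : SimStart .rewind .leftEnd (.idle (.main M.q₀)) .stay
  | accept {s} : SimStart (.main M.qacc) s (.idle .acc) .stay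
  | guess {s q} : q ≠ M.qacc → SimStart (.main q) s (.guess q) .stay
  | nextHead {s} (i : Fin k) (q) : SimStart (.next i.castSucc q) s (.idle (.seek i q)) .stay
  | nextBlock {s q} : SimStart (.next (Fin.last k) q) s (.idle (.main q)) .stay
  | seek {s i q} : SimStart (.seek i q) s (.seek i true q) .stay
  | seekMarks {s i q} : SimStart (.seek i q) s (.seekMarks i q) .stay
  | verify {s i q} : SimStart (.verify i q) s (.verify i q) .stay
  | back {s i q} : SimStart (.back i q) s (.back i true q) .stay
  | backMarks {s i q} : SimStart (.back i q) s (.backMarks i q) .stay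

/-- How the sweeps of the simulation process a cell. The task `seek` decrements the quotient of a
head while the input head moves right, the task `back` increments it while the input head moves
left. -/
inductive SimRewrite : M.Task → InputSymbol α → Cell k α → M.Task → Cell k α → HeadMove → Prop
  | count {s d c c' b} : AddCarry c d.countBit c' b →
      SimRewrite (.count c) s d (.count c') ⟨b, d.headBits, d.record⟩ .stay
  | idle {s d r} : SimRewrite (.idle r) s d (.idle r) d .stay
  | guess {s d q q'} {f : Record k α} : q ≠ M.qacc → q ≠ M.qrej →
      (q', fun i => (f i).2) ∈ M.δ q (fun i => (f i).1) →
      SimRewrite (.guess q) s d (.guess q') ⟨d.countBit, d.headBits, some f⟩ .stay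
  | pad {s d} :
      SimRewrite (.guess M.qacc) s d (.guess M.qacc) ⟨d.countBit, d.headBits, none⟩ .stay
  | seek {s d i c c' b q} : s ≠ .rightEnd → AddCarry c b c' (d.headBits i).1 →
      SimRewrite (.seek i c q) s d (.seek i c' q)
        ⟨d.countBit, Function.update d.headBits i (b, (d.headBits i).2), d.record⟩ .right
  | noMark {s d i q} : d.headBits i = (false, false) →
      SimRewrite (.seekMarks i q) s d (.seekMarks i q) d .stay
  | mark {s d i q} : d.headBits i = (false, true) → s ≠ .rightEnd →
      SimRewrite (.seekMarks i q) s d (.seekMarks i q) d .right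
  | verify {d i q} {f : Record k α} : d.record = some f →
      SimRewrite (.verify i q) (f i).1 d (.verify i q) d (f i).2
  | verifyPad {s d i q} : d.record = none →
      SimRewrite (.verify i q) s d (.verify i q) d .stay
  | back {s d i c c' b q} : s ≠ .leftEnd → AddCarry c (d.headBits i).1 c' b →
      SimRewrite (.back i c q) s d (.back i c' q)
        ⟨d.countBit, Function.update d.headBits i (b, (d.headBits i).2), d.record⟩ .left
  | setNoMark {s d i q} : SimRewrite (.backMarks i q) s d (.backMarks i q)
        ⟨d.countBit, Function.update d.headBits i ((d.headBits i).1, false), d.record⟩ .stay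
  | setMark {s d i q} : s ≠ .leftEnd → SimRewrite (.backMarks i q) s d (.backMarks i q)
        ⟨d.countBit, Function.update d.headBits i ((d.headBits i).1, true), d.record⟩ .left

/-- How the sweeps of the simulation finish. -/
inductive SimFinish : M.Task → InputSymbol α → M.Control → Option (Cell k α) → Prop
  | count {s} : SimFinish (.count false) s .setup none
  | extend {s} : SimFinish (.count true) s .setup (some ⟨true, fun _ => (false, false), none⟩)
  | idle {s r} : SimFinish (.idle r) s r none
  | guess {s q} : SimFinish (.guess q) s (.next 0 q) none
  | seek {s i q} : SimFinish (.seek i false q) s (.seek i q) none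
  | seekMarks {s i q} : SimFinish (.seekMarks i q) s (.verify i q) none
  | verify {s i q} : SimFinish (.verify i q) s (.back i q) none
  | back {s i q} : SimFinish (.back i false q) s (.back i q) none
  | backMarks {i q} : SimFinish (.backMarks i q) .leftEnd (.next i.succ q) none

/-- The sweeping machine that simulates `M`. -/
abbrev sim [Finite α] : Sweeper α where
  Q := M.Control
  finite_Q := Control.finite M
  A := M.Task
  finite_A := Task.finite M
  D := Cell k α
  finite_D := Cell.finite k α
  Start := M.SimStart
  Rewrite := M.SimRewrite
  Finish := M.SimFinish
  q₀ := .setup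
  qacc := .acc
  q₀_ne_qacc := nofun

/-! ### Runs along guessed records -/

variable {M}

/-- The state runs from `q` to `q'` along the given records, where `none` stands for a step that an
automaton in the accept state does not make. -/
def StateRun (M : TwoNFA k α) : M.Q → List (Option (Record k α)) → M.Q → Prop
  | q, [], q' => q = q'
  | q, none :: l, q' => q = M.qacc ∧ StateRun M q l q'
  | q, some f :: l, q' => q ≠ M.qacc ∧ q ≠ M.qrej ∧
      ∃ q₁, (q₁, fun i => (f i).2) ∈ M.δ q (fun i => (f i).1) ∧ StateRun M q₁ l q'

/-- Head `i` moves from `p` to `p'` along the given records and reads the recorded symbols. -/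
def HeadRun (x : List α) (i : Fin k) : ℕ → List (Option (Record k α)) → ℕ → Prop
  | p, [], p' => p = p'
  | p, none :: l, p' => HeadRun x i p l p'
  | p, some f :: l, p' => (f i).1 = inputCell x p ∧ HeadRun x i ((f i).2.onInput x.length p) l p'

theorem StateRun.eq_qacc {q : M.Q} {l : List (Option (Record k α))} (h : StateRun M M.qacc l q) :
    q = M.qacc := by
  induction l with
  | nil => exact h.symm
  | cons o l ih =>
    cases o with
    | none => exact ih h.2
    | some f => exact absurd rfl h.1

theorem stateRun_replicate_none (n : ℕ) : StateRun M M.qacc (List.replicate n none) M.qacc := by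
  induction n with
  | zero => rfl
  | succ _ ih => exact ⟨rfl, ih⟩

theorem headRun_replicate_none (x : List α) (i : Fin k) (p n : ℕ) :
    HeadRun x i p (List.replicate n none) p := by
  induction n with
  | zero => rfl
  | succ _ ih => exact ih

theorem HeadRun.le {x : List α} {i : Fin k} {p p' : ℕ} {l : List (Option (Record k α))}
    (h : HeadRun x i p l p') (hp : p ≤ x.length + 1) : p' ≤ x.length + 1 := by
  induction l generalizing p with
  | nil => exact h ▸ hp
  | cons o l ih =>
    cases o with
    | none => exact ih h hp
    | some f => exact ih h.2 (HeadMove.onInput_le _ hp)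

theorem reaches_of_runs {x : List α} {q q' : M.Q} {P P' : Fin k → ℕ}
    {l : List (Option (Record k α))} (hq : StateRun M q l q')
    (hP : ∀ i, HeadRun x i (P i) l (P' i)) :
    ∃ t, ReachesIn (M.Step x) t ⟨q, P⟩ ⟨q', P'⟩ ∧ (q' ≠ M.qacc → t = l.length) := by
  induction l generalizing q P with
  | nil =>
    obtain rfl : q = q' := hq
    obtain rfl : P = P' := funext hP
    exact ⟨0, .refl _, fun _ => rfl⟩
  | cons o l ih =>
    cases o with
    | none =>
      obtain ⟨rfl, hq⟩ := hq
      obtain ⟨t, ht, -⟩ := ih hq hP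
      exact ⟨t, ht, fun hne => absurd hq.eq_qacc hne⟩
    | some f =>
      obtain ⟨hacc, hrej, q₁, hδ, hq⟩ := hq
      obtain ⟨t, ht, h_len⟩ := ih hq fun i => (hP i).2
      have h_read : (fun i => (f i).1) = fun i => inputCell x (P i) := funext fun i => (hP i).1
      have h_step : M.Step x ⟨q, P⟩ ⟨q₁, fun i => (f i).2.onInput x.length (P i)⟩ :=
        ⟨hacc, hrej, _, h_read ▸ hδ, rfl⟩
      exact ⟨t + 1, ReachesIn.succ_iff.2 ⟨_, h_step, ht⟩, fun hne => congrArg (· + 1) (h_len hne)⟩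

theorem exists_runs_of_reaches {x : List α} {t n : ℕ} {c d : M.Cfg}
    (h : ReachesIn (M.Step x) t c d) (htn : t ≤ n) (h_end : t = n ∨ d.state = M.qacc) :
    ∃ l : List (Option (Record k α)), l.length = n ∧ StateRun M c.state l d.state ∧
      ∀ i, HeadRun x i (c.pos i) l (d.pos i) := by
  induction t generalizing c n with
  | zero =>
    cases h
    refine ⟨List.replicate n none, List.length_replicate, ?_, fun i => headRun_replicate_none ..⟩
    rcases h_end with rfl | h_acc
    · rfl
    · exact h_acc ▸ stateRun_replicate_none n
  | succ t ih =>
    obtain ⟨e, ⟨hacc, hrej, m, hδ, h_pos⟩, h⟩ := ReachesIn.succ_iff.1 h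
    obtain ⟨n, rfl⟩ : ∃ n', n = n' + 1 := Nat.exists_eq_add_one.2 (Nat.zero_lt_of_lt htn)
    obtain ⟨l, rfl, hq, hP⟩ :=
      ih h (Nat.le_of_succ_le_succ htn) (h_end.imp_left Nat.add_right_cancel)
    simp only [h_pos] at hP
    exact ⟨some (fun i => (inputCell x (c.pos i), m i)) :: l, rfl, ⟨hacc, hrej, _, hδ, hq⟩,
      fun i => ⟨rfl, hP i⟩⟩

theorem pos_le_of_reaches {x : List α} {t : ℕ} {c : M.Cfg} (h : ReachesIn (M.Step x) t M.init c)
    (i : Fin k) : c.pos i ≤ x.length + 1 := by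
  refine h.invariant (I := fun _ c => c.pos i ≤ x.length + 1) (Nat.zero_le _) fun _ d e hd hs => ?_
  obtain ⟨-, -, m, -, h_pos⟩ := hs
  rw [h_pos]
  exact HeadMove.onInput_le _ hd

/-! ### The effect of the sweeps -/

section Sweeps

variable [Finite α] {x : List α}

theorem sweep_count {c : Bool} {p p' : ℕ} {w w' : List (Cell k α)} {a' : M.Task}
    (h : M.sim.Sweep x (.count c) p w a' p' w') :
    ∃ c', a' = .count c' ∧ p' = p ∧ (∀ i, track i w' = track i w) ∧
      c.toNat + counter w = counter w' + 2 ^ w.length * c'.toNat := by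
  induction w generalizing c w' with
  | nil =>
    obtain ⟨rfl, rfl, rfl⟩ := Sweeper.sweep_nil_iff.1 h
    exact ⟨c, rfl, rfl, fun _ => rfl, by simp [counter, bitVal]⟩
  | cons d w ih =>
    obtain ⟨a₁, d', mv, v, ⟨h_add⟩, hs, rfl⟩ := Sweeper.sweep_cons_iff.1 h
    obtain ⟨c', rfl, rfl, h_track, h_val⟩ := ih hs
    refine ⟨c', rfl, rfl, fun i => congrArg (d.headBits i :: ·) (h_track i), ?_⟩
    rw [counter_cons, counter_cons, List.length_cons, pow_succ]
    rw [AddCarry] at h_add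
    linear_combination h_add + 2 * h_val

theorem exists_sweep_count (c : Bool) (p : ℕ) (w : List (Cell k α)) :
    ∃ c' w', M.sim.Sweep x (.count c) p w (.count c') p w' := by
  induction w generalizing c with
  | nil => exact ⟨c, [], .nil _ _⟩
  | cons d w ih =>
    obtain ⟨c₁, b, h_add⟩ := AddCarry.exists_add c d.countBit
    obtain ⟨c', w', hs⟩ := ih c₁
    exact ⟨c', _, .cons (SimRewrite.count h_add) hs⟩

theorem sweep_idle_iff {r : M.Control} {p p' : ℕ} {w w' : List (Cell k α)} {a' : M.Task} :
    M.sim.Sweep x (.idle r) p w a' p' w' ↔ a' = .idle r ∧ p' = p ∧ w' = w := by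
  induction w generalizing w' with
  | nil => exact Sweeper.sweep_nil_iff
  | cons d w ih =>
    constructor
    · intro h
      obtain ⟨a₁, d', mv, v, ⟨⟩, hs, rfl⟩ := Sweeper.sweep_cons_iff.1 h
      obtain ⟨rfl, rfl, rfl⟩ := ih.1 hs
      exact ⟨rfl, rfl, rfl⟩
    · rintro ⟨rfl, rfl, rfl⟩
      exact .cons SimRewrite.idle (ih.2 ⟨rfl, rfl, rfl⟩)

theorem sweep_guess {q : M.Q} {p p' : ℕ} {w w' : List (Cell k α)} {a' : M.Task}
    (h : M.sim.Sweep x (.guess q) p w a' p' w') :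
    ∃ q', a' = .guess q' ∧ p' = p ∧ StateRun M q (records w') q' ∧
      ∀ i, track i w' = track i w := by
  induction w generalizing q w' with
  | nil =>
    obtain ⟨rfl, rfl, rfl⟩ := Sweeper.sweep_nil_iff.1 h
    exact ⟨q, rfl, rfl, rfl, fun _ => rfl⟩
  | cons d w ih =>
    obtain ⟨a₁, d', mv, v, hr, hs, rfl⟩ := Sweeper.sweep_cons_iff.1 h
    cases hr with
    | guess hacc hrej hδ =>
      obtain ⟨q', rfl, rfl, h_run, h_track⟩ := ih hs
      exact ⟨q', rfl, rfl, ⟨hacc, hrej, _, hδ, h_run⟩,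
        fun i => congrArg (d.headBits i :: ·) (h_track i)⟩
    | pad =>
      obtain ⟨q', rfl, rfl, h_run, h_track⟩ := ih hs
      exact ⟨q', rfl, rfl, ⟨rfl, h_run⟩, fun i => congrArg (d.headBits i :: ·) (h_track i)⟩

theorem exists_sweep_guess {q q' : M.Q} {l : List (Option (Record k α))} (h : StateRun M q l q')
    (p : ℕ) {w : List (Cell k α)} (hl : l.length = w.length) :
    ∃ w', M.sim.Sweep x (.guess q) p w (.guess q') p w' ∧ records w' = l ∧
      ∀ i, track i w' = track i w := by
  induction w generalizing q l with
  | nil =>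
    obtain rfl := List.length_eq_zero_iff.1 hl
    obtain rfl : q = q' := h
    exact ⟨[], .nil _ _, rfl, fun _ => rfl⟩
  | cons d w ih =>
    match l, h with
    | none :: l, ⟨hq, h_run⟩ =>
      obtain ⟨w', hs, rfl, h_track⟩ := ih h_run (Nat.succ.inj hl)
      subst hq
      exact ⟨_, .cons SimRewrite.pad hs, rfl, fun i => congrArg (d.headBits i :: ·) (h_track i)⟩
    | some f :: l, ⟨hacc, hrej, q₁, hδ, h_run⟩ =>
      obtain ⟨w', hs, rfl, h_track⟩ := ih h_run (Nat.succ.inj hl)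
      exact ⟨_, .cons (SimRewrite.guess hacc hrej hδ) hs, rfl,
        fun i => congrArg (d.headBits i :: ·) (h_track i)⟩

theorem sweep_seek {i : Fin k} {c : Bool} {q : M.Q} {p p' : ℕ} {w w' : List (Cell k α)}
    {a' : M.Task} (h : M.sim.Sweep x (.seek i c q) p w a' p' w') (hp : p ≤ x.length + 1) :
    ∃ c', a' = .seek i c' q ∧ p' = p + w.length ∧ p' ≤ x.length + 1 ∧ SameOff i w w' ∧
      headRem i w' = headRem i w ∧
      c.toNat + headQuot i w' = headQuot i w + 2 ^ w.length * c'.toNat := by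
  induction w generalizing c p w' with
  | nil =>
    obtain ⟨rfl, rfl, rfl⟩ := Sweeper.sweep_nil_iff.1 h
    exact ⟨c, rfl, rfl, hp, .refl _ _, rfl, by simp [headQuot, track, bitVal]⟩
  | cons d w ih =>
    obtain ⟨a₁, d', mv, v, hr, hs, rfl⟩ := Sweeper.sweep_cons_iff.1 h
    cases hr with | seek h_right h_add => ?_
    rw [inputCell_ne_rightEnd_iff] at h_right
    rw [HeadMove.onInput_right h_right] at hs
    obtain ⟨c', rfl, rfl, hp', h_same, h_rem, h_val⟩ := ih hs (Nat.succ_le_succ h_right)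
    refine ⟨c', rfl, by rw [List.length_cons]; ring, hp', h_same.cons d _, ?_, ?_⟩
    · simp only [headRem_cons, Function.update_self, h_rem]
    · simp only [headQuot_cons, Function.update_self, List.length_cons, pow_succ]
      rw [AddCarry] at h_add
      linear_combination h_add + 2 * h_val

theorem exists_sweep_seek (i : Fin k) (c : Bool) (q : M.Q) {p : ℕ} {w : List (Cell k α)}
    (hp : p + w.length ≤ x.length + 1) :
    ∃ c' w', M.sim.Sweep x (.seek i c q) p w (.seek i c' q) (p + w.length) w' := by
  induction w generalizing c p with
  | nil => exact ⟨c, [], .nil _ _⟩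
  | cons d w ih =>
    rw [List.length_cons] at hp ⊢
    obtain ⟨c₁, b, h_add⟩ := AddCarry.exists_sub c (d.headBits i).1
    obtain ⟨c', w', hs⟩ := ih (p := p + 1) c₁ (by omega)
    have h_right : p ≤ x.length := by omega
    rw [Nat.add_right_comm, ← HeadMove.onInput_right h_right] at hs
    exact ⟨c', _, .cons (SimRewrite.seek (inputCell_ne_rightEnd_iff.2 h_right) h_add) hs⟩

theorem sweep_seekMarks_iff {i : Fin k} {q : M.Q} {p p' : ℕ} {w w' : List (Cell k α)}
    {a' : M.Task} (hp : p ≤ x.length + 1) :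
    M.sim.Sweep x (.seekMarks i q) p w a' p' w' ↔ a' = .seekMarks i q ∧ w' = w ∧
      headQuot i w = 0 ∧ p' = p + headRem i w ∧ p' ≤ x.length + 1 := by
  induction w generalizing p p' w' with
  | nil =>
    rw [Sweeper.sweep_nil_iff]
    simp only [headQuot, headRem, track, bitVal, List.map_nil, Nat.ofDigits_nil,
      List.countP_nil, add_zero]
    grind
  | cons d w ih =>
    rw [Sweeper.sweep_cons_iff, headQuot_cons, headRem_cons]
    constructor
    · rintro ⟨a₁, d', mv, v, hr, hs, rfl⟩
      cases hr with
      | noMark h_bits =>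
        obtain ⟨rfl, rfl, h_quot, rfl, hp'⟩ := (ih hp).1 hs
        simpa [h_bits, h_quot] using hp'
      | mark h_bits h_right =>
        rw [inputCell_ne_rightEnd_iff] at h_right
        rw [HeadMove.onInput_right h_right, ih (Nat.succ_le_succ h_right)] at hs
        obtain ⟨rfl, rfl, h_quot, rfl, hp'⟩ := hs
        exact ⟨rfl, rfl, by simp [h_bits, h_quot], by simp [h_bits]; ring, hp'⟩
    · rintro ⟨rfl, rfl, h_quot, rfl, hp'⟩
      obtain ⟨h_bit, h_quot⟩ : (d.headBits i).1 = false ∧ headQuot i w = 0 := by simpa using h_quot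
      cases h_mark : (d.headBits i).2 with
      | false =>
        refine ⟨_, _, _, _, SimRewrite.noMark (Prod.ext h_bit h_mark), ?_, rfl⟩
        rw [HeadMove.onInput_stay, ih hp]
        exact ⟨rfl, rfl, h_quot, rfl, by simpa [h_mark] using hp'⟩
      | true =>
        have h_right : p ≤ x.length := by
          rw [h_mark, Bool.toNat_true] at hp'
          omega
        refine ⟨_, _, _, _, SimRewrite.mark (Prod.ext h_bit h_mark)
          (inputCell_ne_rightEnd_iff.2 h_right), ?_, rfl⟩
        rw [HeadMove.onInput_right h_right, ih (Nat.succ_le_succ h_right)]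
        rw [h_mark] at hp'
        exact ⟨rfl, rfl, h_quot, by rw [Bool.toNat_true]; omega, hp'⟩

theorem sweep_verify_iff {i : Fin k} {q : M.Q} {p p' : ℕ} {w w' : List (Cell k α)}
    {a' : M.Task} :
    M.sim.Sweep x (.verify i q) p w a' p' w' ↔
      a' = .verify i q ∧ w' = w ∧ HeadRun x i p (records w) p' := by
  induction w generalizing p p' w' with
  | nil =>
    rw [Sweeper.sweep_nil_iff]
    exact and_congr_right' (and_comm.trans (and_congr_right' eq_comm))
  | cons d w ih =>
    rw [Sweeper.sweep_cons_iff]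
    constructor
    · rintro ⟨a₁, d', mv, v, hr, hs, rfl⟩
      generalize h_read : inputCell x p = s at hr
      cases hr with
      | verify h_rec =>
        obtain ⟨rfl, rfl, h_run⟩ := ih.1 hs
        exact ⟨rfl, rfl, by simpa [records, HeadRun, h_rec, h_read] using h_run⟩
      | verifyPad h_rec =>
        obtain ⟨rfl, rfl, h_run⟩ := ih.1 hs
        exact ⟨rfl, rfl, by simpa [records, HeadRun, h_rec, HeadMove.onInput_stay] using h_run⟩
    · rintro ⟨rfl, rfl, h_run⟩
      cases h_rec : d.record with
      | none =>
        refine ⟨_, _, _, _, SimRewrite.verifyPad h_rec, ih.2 ⟨rfl, rfl, ?_⟩, rfl⟩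
        simpa [records, HeadRun, h_rec, HeadMove.onInput_stay] using h_run
      | some f =>
        have h_run' : (f i).1 = inputCell x p ∧
            HeadRun x i ((f i).2.onInput x.length p) (records w) p' := by
          simpa [records, HeadRun, h_rec] using h_run
        exact ⟨_, _, _, _, h_run'.1 ▸ SimRewrite.verify h_rec, ih.2 ⟨rfl, rfl, h_run'.2⟩, rfl⟩

theorem sweep_back {i : Fin k} {c : Bool} {q : M.Q} {p p' : ℕ} {w w' : List (Cell k α)}
    {a' : M.Task} (h : M.sim.Sweep x (.back i c q) p w a' p' w') :
    ∃ c', a' = .back i c' q ∧ p' + w.length = p ∧ SameOff i w w' ∧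
      headRem i w' = headRem i w ∧
      c.toNat + headQuot i w = headQuot i w' + 2 ^ w.length * c'.toNat := by
  induction w generalizing c p w' with
  | nil =>
    obtain ⟨rfl, rfl, rfl⟩ := Sweeper.sweep_nil_iff.1 h
    exact ⟨c, rfl, rfl, .refl _ _, rfl, by simp [headQuot, track, bitVal]⟩
  | cons d w ih =>
    obtain ⟨a₁, d', mv, v, hr, hs, rfl⟩ := Sweeper.sweep_cons_iff.1 h
    cases hr with | back h_left h_add => ?_
    obtain ⟨c', rfl, hp', h_same, h_rem, h_val⟩ := ih hs
    rw [Ne, inputCell_eq_leftEnd_iff] at h_left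
    rw [HeadMove.onInput_left] at hp'
    refine ⟨c', rfl, by rw [List.length_cons]; omega, h_same.cons d _, ?_, ?_⟩
    · simp only [headRem_cons, Function.update_self, h_rem]
    · simp only [headQuot_cons, Function.update_self, List.length_cons, pow_succ]
      rw [AddCarry] at h_add
      linear_combination h_add + 2 * h_val

theorem exists_sweep_back (i : Fin k) (c : Bool) (q : M.Q) (p : ℕ) (w : List (Cell k α)) :
    ∃ c' w', M.sim.Sweep x (.back i c q) (p + w.length) w (.back i c' q) p w' := by
  induction w generalizing c with
  | nil => exact ⟨c, [], .nil _ _⟩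
  | cons d w ih =>
    obtain ⟨c₁, b, h_add⟩ := AddCarry.exists_add c (d.headBits i).1
    obtain ⟨c', w', hs⟩ := ih c₁
    exact ⟨c', _, .cons (SimRewrite.back (inputCell_eq_leftEnd_iff.not.2 (Nat.succ_ne_zero _))
      h_add) hs⟩

theorem sweep_backMarks {i : Fin k} {q : M.Q} {p p' : ℕ} {w w' : List (Cell k α)}
    {a' : M.Task} (h : M.sim.Sweep x (.backMarks i q) p w a' p' w') :
    a' = .backMarks i q ∧ p' + headRem i w' = p ∧ SameOff i w w' ∧
      headQuot i w' = headQuot i w := by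
  induction w generalizing p w' with
  | nil =>
    obtain ⟨rfl, rfl, rfl⟩ := Sweeper.sweep_nil_iff.1 h
    exact ⟨rfl, rfl, .refl _ _, rfl⟩
  | cons d w ih =>
    obtain ⟨a₁, d', mv, v, hr, hs, rfl⟩ := Sweeper.sweep_cons_iff.1 h
    cases hr with
    | setNoMark =>
      obtain ⟨rfl, hp', h_same, h_quot⟩ := ih hs
      refine ⟨rfl, ?_, h_same.cons d _, ?_⟩
      · simpa [headRem_cons, HeadMove.onInput_stay] using hp'
      · simp only [headQuot_cons, Function.update_self, h_quot]
    | setMark h_left =>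
      obtain ⟨rfl, hp', h_same, h_quot⟩ := ih hs
      rw [Ne, inputCell_eq_leftEnd_iff] at h_left
      rw [HeadMove.onInput_left] at hp'
      refine ⟨rfl, ?_, h_same.cons d _, ?_⟩
      · simp only [headRem_cons, Function.update_self, Bool.toNat_true]
        omega
      · simp only [headQuot_cons, Function.update_self, h_quot]

theorem exists_sweep_backMarks (i : Fin k) (q : M.Q) (p : ℕ) {r : ℕ} {w : List (Cell k α)}
    (hr : r ≤ w.length) :
    ∃ w', M.sim.Sweep x (.backMarks i q) (p + r) w (.backMarks i q) p w' := by
  induction w generalizing r with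
  | nil =>
    obtain rfl := Nat.le_zero.1 hr
    exact ⟨[], .nil _ _⟩
  | cons d w ih =>
    cases r with
    | zero =>
      obtain ⟨w', hs⟩ := ih (Nat.zero_le _)
      exact ⟨_, .cons SimRewrite.setNoMark hs⟩
    | succ r =>
      obtain ⟨w', hs⟩ := ih (Nat.le_of_succ_le_succ hr)
      exact ⟨_, .cons (SimRewrite.setMark (inputCell_eq_leftEnd_iff.not.2 (Nat.succ_ne_zero _)))
        hs⟩


end Sweeps

/-! ### The invariant of the simulation -/

/-- The length of the blocks of steps that are simulated together, for inputs of length `n`. -/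
def blockLen (n : ℕ) : ℕ := (n + 1).size

/-- The number of strides of length `blockLen n` that fit on the tape of an input of length `n`. -/
def strides (n : ℕ) : ℕ := (n + 1) / blockLen n

/-- A bound for the number of sweeps spent on one head in one block: the strides in both directions,
one sweep each from `next` and `verify`, and the sweeps that end `seek` and `back`. -/
def headCost (n : ℕ) : ℕ := 2 * strides n + 4

/-- A bound for the number of sweeps before block `B`. -/
def sweepsBefore (k n B : ℕ) : ℕ := 2 * n + 4 + B * (k * headCost n + 2)

/-- A bound for the number of sweeps before head `i` is processed in block `B`. -/
def sweepsBeforeHead (k n B i : ℕ) : ℕ := sweepsBefore k n B + 1 + i * headCost n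

theorem blockLen_pos (n : ℕ) : 0 < blockLen n := Nat.size_pos.2 n.succ_pos

theorem le_strides {n a : ℕ} (h : a * blockLen n ≤ n + 1) : a ≤ strides n :=
  (Nat.le_div_iff_mul_le (blockLen_pos n)).2 h

theorem sweepsBefore_mono {k n B B' : ℕ} (h : B ≤ B') :
    sweepsBefore k n B ≤ sweepsBefore k n B' :=
  Nat.add_le_add_left (Nat.mul_le_mul_right _ h) _

theorem sweepsBefore_succ (k n B : ℕ) :
    sweepsBefore k n (B + 1) = sweepsBeforeHead k n B k + 1 := by
  simp only [sweepsBefore, sweepsBeforeHead]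
  ring

theorem sweepsBeforeHead_succ (k n B i : ℕ) :
    sweepsBeforeHead k n B (i + 1) = sweepsBeforeHead k n B i + (2 * strides n + 4) := by
  simp only [sweepsBeforeHead, headCost]
  ring

theorem sweepsBeforeHead_le {k n B i : ℕ} (h : i ≤ k) :
    sweepsBeforeHead k n B i ≤ sweepsBefore k n (B + 1) := by
  rw [sweepsBefore_succ]
  exact (Nat.add_le_add_left (Nat.mul_le_mul_right _ h) _).trans (Nat.le_succ _)

/-- The word records all heads at position `0`. -/
def Fresh (w : List (Cell k α)) : Prop := ∀ i, headQuot i w = 0 ∧ headRem i w = 0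

theorem Fresh.headPos_eq_zero {w : List (Cell k α)} (h : Fresh w) (i : Fin k) :
    headPos i w = 0 := by
  rw [headPos, (h i).1, (h i).2, zero_mul]

theorem Fresh.congr {w w' : List (Cell k α)} (h : Fresh w) (hw : ∀ i, track i w' = track i w) :
    Fresh w' := fun i => by
  simpa only [headQuot, headRem, hw i] using h i

theorem Fresh.concat {w : List (Cell k α)} (h : Fresh w) (b : Bool)
    (o : Option (Record k α)) : Fresh (w ++ [⟨b, fun _ => (false, false), o⟩]) := fun i => by
  have h_track : track i (w ++ [⟨b, fun _ => (false, false), o⟩]) =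
      track i w ++ [(false, false)] := List.map_append
  have h_bit : bitVal [false] = 0 := rfl
  obtain ⟨h_quot, h_rem⟩ := h i
  rw [headQuot] at h_quot
  rw [headRem] at h_rem
  simp [headQuot, headRem, h_track, bitVal_append, h_quot, h_rem, h_bit]

variable (M) in
/-- The `t` steps that lead `M` to the configuration `c` fill at least `B` blocks, and the records
in `w` lead from `c` to the state `q`. The word `w` encodes the positions of the heads before `i` at
the end of these records and the positions of the heads after `i` in `c`. -/
structure InBlock (x : List α) (q : M.Q) (w : List (Cell k α)) (i : ℕ) (c : M.Cfg) (t B : ℕ) :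
    Prop where
  length_eq : w.length = blockLen x.length
  reach : ReachesIn (M.Step x) t M.init c
  full : B * blockLen x.length ≤ t
  stateRun : StateRun M c.state (records w) q
  done (j : Fin k) : j < i → HeadRun x j (c.pos j) (records w) (headPos j w)
  todo (j : Fin k) : i < j → headPos j w = c.pos j

variable (M) in
/-- The invariant of the simulation after `m` sweeps, with the input head on cell `p` and the
word `w`. In the states `seek` and `back`, the number `a` counts the strides that the input head
has made. -/
inductive SimInv (x : List α) : ℕ → M.Control → ℕ → List (Cell k α) → Prop
  | setup {p w} (fresh : Fresh w) (length_eq : w.length = p.size) (counter_eq : counter w = p)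
      (le : p ≤ x.length + 1) : SimInv x p .setup p w
  | rewind {m p w} (fresh : Fresh w) (length_eq : w.length = blockLen x.length)
      (sweeps : m + p ≤ 2 * x.length + 3) : SimInv x m .rewind p w
  | main {m w q P t} (B : ℕ) (length_eq : w.length = blockLen x.length)
      (reach : ReachesIn (M.Step x) t M.init ⟨q, P⟩) (pos : ∀ i, headPos i w = P i)
      (le : B * blockLen x.length ≤ t + blockLen x.length)
      (full : q ≠ M.qacc → B * blockLen x.length ≤ t)
      (sweeps : m ≤ sweepsBefore k x.length B) : SimInv x m (.main q) 0 w
  | next {m w} {i : Fin (k + 1)} {q c t} (B : ℕ) (block : InBlock M x q w i c t B)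
      (pos : ∀ j : Fin k, (j : ℕ) = i → headPos j w = c.pos j)
      (sweeps : m ≤ sweepsBeforeHead k x.length B i) : SimInv x m (.next i q) 0 w
  | seek {m p w} {i : Fin k} {q c t B} (a : ℕ) (block : InBlock M x q w i c t B)
      (pos : p + headPos i w = c.pos i) (stride : a * blockLen x.length = p)
      (le : p ≤ x.length + 1) (sweeps : m ≤ sweepsBeforeHead k x.length B i + (a + 1)) :
      SimInv x m (.seek i q) p w
  | verify {m w} {i : Fin k} {q c t B} (block : InBlock M x q w i c t B) (quot : headQuot i w = 0)
      (sweeps : m ≤ sweepsBeforeHead k x.length B i + (strides x.length + 2)) :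
      SimInv x m (.verify i q) (c.pos i) w
  | back {m p w} {i : Fin k} {q c t B} (a : ℕ) (block : InBlock M x q w i c t B)
      (headRun : HeadRun x i (c.pos i) (records w) (headQuot i w * blockLen x.length + p))
      (stride : a * blockLen x.length + p ≤ x.length + 1)
      (sweeps : m ≤ sweepsBeforeHead k x.length B i + (strides x.length + 3 + a)) :
      SimInv x m (.back i q) p w
  | acc {m p w c t B} (length_eq : w.length = blockLen x.length)
      (reach : ReachesIn (M.Step x) t M.init c) (accepting : c.state = M.qacc)
      (le : B * blockLen x.length ≤ t + blockLen x.length)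
      (sweeps : m ≤ sweepsBefore k x.length B + 1) : SimInv x m .acc p w

section Invariant

variable {x : List α} {m p p' i t B : ℕ} {q : M.Q} {w w' : List (Cell k α)} {c : M.Cfg}

theorem SameOff.length_eq {i : Fin k} (h : SameOff i w w') : w'.length = w.length := by
  simpa [records] using congrArg List.length h.1

theorem InBlock.congr {i : Fin k} (h : InBlock M x q w i c t B) (hw : SameOff i w w') :
    InBlock M x q w' i c t B where
  length_eq := hw.length_eq.trans h.length_eq
  reach := h.reach
  full := h.full
  stateRun := hw.1 ▸ h.stateRun
  done j hj := by
    rw [hw.1, hw.headPos_eq (Fin.ne_of_lt hj)]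
    exact h.done j hj
  todo j hj := by
    rw [hw.headPos_eq (Fin.ne_of_gt hj)]
    exact h.todo j hj

theorem InBlock.succ {i : Fin k} (h : InBlock M x q w i c t B)
    (h_run : HeadRun x i (c.pos i) (records w) (headPos i w)) :
    InBlock M x q w (i + 1) c t B where
  __ := h
  done j hj := by
    rcases Nat.lt_succ_iff_lt_or_eq.1 hj with hj | hj
    · exact h.done j hj
    · exact Fin.ext hj ▸ h_run
  todo j hj := h.todo j (Nat.lt_of_succ_lt hj)

theorem InBlock.exists_reaches (h : InBlock M x q w k c t B) :
    ∃ t', ReachesIn (M.Step x) t' M.init ⟨q, fun i => headPos i w⟩ ∧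
      t ≤ t' ∧ (q ≠ M.qacc → t' = t + blockLen x.length) := by
  obtain ⟨s, hs, h_len⟩ := reaches_of_runs h.stateRun fun j => h.done j j.isLt
  refine ⟨t + s, h.reach.trans hs, Nat.le_add_right t s, fun hq => ?_⟩
  rw [h_len hq, records, List.length_map, h.length_eq]

variable (M x) in
/-- Some path of `M` is long enough to account for `m` sweeps of the simulation. The last of its `B`
blocks need not be complete. -/
def AccountsFor (m : ℕ) : Prop :=
  ∃ t c B, ReachesIn (M.Step x) t M.init c ∧
    B * blockLen x.length ≤ t + blockLen x.length ∧ m ≤ sweepsBefore k x.length B + 1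

theorem accountsFor_of_le (h : m ≤ 2 * x.length + 3) : AccountsFor M x m :=
  ⟨0, M.init, 0, .refl _, by omega, by rw [sweepsBefore]; omega⟩

theorem InBlock.accountsFor {i' : ℕ} (h : InBlock M x q w i c t B) (hi' : i' ≤ k)
    (hm : m ≤ sweepsBeforeHead k x.length B i') : AccountsFor M x m :=
  ⟨t, c, B + 1, h.reach, by rw [Nat.succ_mul]; exact Nat.add_le_add_right h.full _,
    (hm.trans (sweepsBeforeHead_le hi')).trans (Nat.le_succ _)⟩

theorem InBlock.accountsFor_head {i : Fin k} (h : InBlock M x q w i c t B)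
    (hm : m ≤ sweepsBeforeHead k x.length B i + (2 * strides x.length + 4)) :
    AccountsFor M x m :=
  h.accountsFor i.isLt (hm.trans_eq (sweepsBeforeHead_succ ..).symm)

theorem SimInv.length_le {r : M.Control} (h : SimInv M x m r p w) :
    w.length ≤ blockLen x.length := by
  cases h with
  | setup _ length_eq _ le => exact length_eq ▸ Nat.size_le_size le
  | rewind _ length_eq => exact length_eq.le
  | main _ length_eq => exact length_eq.le
  | acc length_eq => exact length_eq.le
  | next _ block | seek _ block | verify block | back _ block => exact block.length_eq.le

theorem SimInv.accountsFor {r : M.Control} (h : SimInv M x m r p w) : AccountsFor M x m := by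
  cases h with
  | setup _ _ _ le => exact accountsFor_of_le (by omega)
  | rewind _ _ sweeps => exact accountsFor_of_le (by omega)
  | main _ _ reach _ le _ sweeps => exact ⟨_, _, _, reach, le, sweeps.trans (Nat.le_succ _)⟩
  | acc _ reach _ le sweeps => exact ⟨_, _, _, reach, le, sweeps⟩
  | next B block _ sweeps => exact block.accountsFor (Fin.is_le _) sweeps
  | seek a block _ stride le sweeps =>
    have := le_strides (stride.trans_le le)
    exact block.accountsFor_head (by omega)
  | verify block _ sweeps =>
    exact block.accountsFor_head (by omega)
  | back a block _ stride sweeps =>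
    have := le_strides (Nat.le_of_add_right_le stride)
    exact block.accountsFor_head (by omega)

theorem SimInv.counted (h : SimInv M x m .setup p w) (hp : x.length < p) :
    SimInv M x (m + 1) .rewind p w := by
  cases h with | setup fresh length_eq _ le => ?_
  obtain rfl : m = x.length + 1 := le_antisymm le hp
  exact .rewind fresh length_eq (by omega)

theorem SimInv.rewind_left (h : SimInv M x m .rewind p w) (hp : p ≠ 0) :
    SimInv M x (m + 1) .rewind (p - 1) w := by
  cases h with | rewind fresh length_eq sweeps => ?_
  exact .rewind fresh length_eq (by omega)

theorem SimInv.rewound (h : SimInv M x m .rewind 0 w) : SimInv M x (m + 1) (.main M.q₀) 0 w := by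
  cases h with | rewind fresh length_eq sweeps => ?_
  refine .main 0 length_eq (.refl _) fresh.headPos_eq_zero ?_ ?_ ?_
  · rw [zero_mul]; exact Nat.zero_le _
  · rw [zero_mul]; exact fun _ => le_rfl
  · rw [sweepsBefore]; omega

theorem SimInv.accept (h : SimInv M x m (.main M.qacc) p w) : SimInv M x (m + 1) .acc p w := by
  cases h with | main B length_eq reach _ le _ sweeps => ?_
  exact .acc length_eq reach rfl le (Nat.succ_le_succ sweeps)

theorem SimInv.nextHead {i : Fin k} (h : SimInv M x m (.next i.castSucc q) p w) :
    SimInv M x (m + 1) (.seek i q) p w := by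
  cases h with | next B block pos sweeps => ?_
  exact .seek 0 block (by rw [zero_add, pos i rfl]) (zero_mul _) (Nat.zero_le _)
    (Nat.succ_le_succ sweeps)

theorem SimInv.nextBlock (h : SimInv M x m (.next (Fin.last k) q) p w) :
    SimInv M x (m + 1) (.main q) p w := by
  cases h with | next B block _ sweeps => ?_
  obtain ⟨t', reach, h_le, h_len⟩ := block.exists_reaches
  have h_full := block.full
  refine .main (B + 1) block.length_eq reach (fun _ => rfl) ?_ (fun hq => ?_) ?_
  · rw [Nat.succ_mul]; omega
  · rw [Nat.succ_mul, h_len hq]; omega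
  · rw [sweepsBefore_succ]; exact Nat.succ_le_succ sweeps

variable [Finite α] {a' : M.Task} {r : M.Control} {o : Option (Cell k α)}

theorem SimInv.count (h : SimInv M x m .setup p w) (hp : p ≤ x.length)
    (hs : M.sim.Sweep x (.count true) (HeadMove.right.onInput x.length p) w a' p' w')
    (hf : M.SimFinish a' (inputCell x p') r o) : SimInv M x (m + 1) r p' (w' ++ o.toList) := by
  obtain ⟨c', rfl, rfl, h_track, h_val⟩ := sweep_count hs
  have h_len : w'.length = w.length := hs.length_eq
  cases h with | setup fresh length_eq counter_eq le => ?_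
  rw [HeadMove.onInput_right hp]
  rw [counter_eq, Bool.toNat_true] at h_val
  have fresh' := fresh.congr h_track
  cases hf with
  | count =>
    rw [Bool.toNat_false, mul_zero, add_zero, add_comm] at h_val
    rw [Option.toList_none, List.append_nil]
    refine .setup fresh' (le_antisymm ?_ ?_) h_val.symm (Nat.succ_le_succ hp)
    · exact h_len.trans_le (length_eq.trans_le (Nat.size_le_size m.le_succ))
    · exact Nat.size_le.2 (h_val ▸ counter_lt w')
  | extend =>
    have h_lt : m < 2 ^ w.length := length_eq ▸ m.lt_size_self
    rw [Bool.toNat_true, mul_one] at h_val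
    have h_pow : m + 1 = 2 ^ w.length := by omega
    refine .setup (fresh'.concat true none) ?_ ?_ (Nat.succ_le_succ hp)
    · rw [h_pow, Nat.size_pow, ← h_len]
      exact List.length_append
    · rw [Option.toList_some, counter_concat, h_len, Bool.toNat_true]
      omega

theorem SimInv.guess (h : SimInv M x m (.main q) p w) (hq : q ≠ M.qacc)
    (hs : M.sim.Sweep x (.guess q) p w a' p' w') (hf : M.SimFinish a' (inputCell x p') r o) :
    SimInv M x (m + 1) r p' (w' ++ o.toList) := by
  obtain ⟨q', rfl, rfl, h_run, h_track⟩ := sweep_guess hs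
  cases hf
  rw [Option.toList_none, List.append_nil]
  cases h with | main B length_eq reach pos _ full sweeps => ?_
  have pos' i : headPos i w' = _ := (headPos_congr (h_track i)).trans (pos i)
  refine .next B ⟨hs.length_eq.trans length_eq, reach, full hq, h_run, nofun, fun j _ => pos' j⟩
    (fun j _ => pos' j) ?_
  simpa [sweepsBeforeHead] using sweeps

theorem SimInv.seek_stride {i : Fin k} (h : SimInv M x m (.seek i q) p w)
    (hs : M.sim.Sweep x (.seek i true q) p w a' p' w')
    (hf : M.SimFinish a' (inputCell x p') r o) : SimInv M x (m + 1) r p' (w' ++ o.toList) := by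
  cases h with | seek a block pos stride le sweeps => ?_
  obtain ⟨c', rfl, rfl, le', h_same, h_rem, h_quot⟩ := sweep_seek hs le
  cases hf
  rw [Option.toList_none, List.append_nil]
  rw [Bool.toNat_true, Bool.toNat_false, mul_zero, add_zero] at h_quot
  refine .seek (a + 1) (block.congr h_same) ?_ ?_ le' ?_
  · rw [← pos, headPos, headPos, h_rem, ← h_quot, h_same.length_eq]
    ring
  · rw [block.length_eq, Nat.succ_mul, stride]
  · omega

theorem SimInv.seek_marks {i : Fin k} (h : SimInv M x m (.seek i q) p w)
    (hs : M.sim.Sweep x (.seekMarks i q) p w a' p' w')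
    (hf : M.SimFinish a' (inputCell x p') r o) : SimInv M x (m + 1) r p' (w' ++ o.toList) := by
  cases h with | seek a block pos stride le sweeps => ?_
  obtain ⟨rfl, rfl, h_quot, rfl, le'⟩ := (sweep_seekMarks_iff le).1 hs
  cases hf
  have := le_strides (stride.trans_le le)
  rw [headPos, h_quot, zero_mul, zero_add] at pos
  rw [Option.toList_none, List.append_nil, pos]
  exact .verify block h_quot (by omega)

theorem SimInv.verified {i : Fin k} (h : SimInv M x m (.verify i q) p w)
    (hs : M.sim.Sweep x (.verify i q) p w a' p' w')
    (hf : M.SimFinish a' (inputCell x p') r o) : SimInv M x (m + 1) r p' (w' ++ o.toList) := by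
  cases h with | verify block quot sweeps => ?_
  obtain ⟨rfl, rfl, h_run⟩ := sweep_verify_iff.1 hs
  cases hf
  rw [Option.toList_none, List.append_nil]
  refine .back 0 block ?_ ?_ (by omega)
  · rwa [quot, zero_mul, zero_add]
  · rw [zero_mul, zero_add]
    exact h_run.le (pos_le_of_reaches block.reach i)

theorem SimInv.back_stride {i : Fin k} (h : SimInv M x m (.back i q) p w)
    (hs : M.sim.Sweep x (.back i true q) p w a' p' w')
    (hf : M.SimFinish a' (inputCell x p') r o) : SimInv M x (m + 1) r p' (w' ++ o.toList) := by
  cases h with | back a block headRun stride sweeps => ?_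
  obtain ⟨c', rfl, h_pos, h_same, h_rem, h_quot⟩ := sweep_back hs
  cases hf
  rw [Option.toList_none, List.append_nil]
  rw [Bool.toNat_true, Bool.toNat_false, mul_zero, add_zero] at h_quot
  rw [block.length_eq] at h_pos
  refine .back (a + 1) (block.congr h_same) ?_ ?_ (by omega)
  · rw [h_same.1, ← h_quot, add_comm 1, Nat.succ_mul, Nat.add_assoc, Nat.add_comm _ p', h_pos]
    exact headRun
  · rw [Nat.succ_mul]; omega

theorem SimInv.back_marks {i : Fin k} (h : SimInv M x m (.back i q) p w)
    (hs : M.sim.Sweep x (.backMarks i q) p w a' p' w')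
    (hf : M.SimFinish a' (inputCell x p') r o) : SimInv M x (m + 1) r p' (w' ++ o.toList) := by
  cases h with | back a block headRun stride sweeps => ?_
  obtain ⟨rfl, rfl, h_same, h_quot⟩ := sweep_backMarks hs
  generalize h_end : inputCell x p' = s at hf
  cases hf
  obtain rfl := inputCell_eq_leftEnd_iff.1 h_end
  have := le_strides (Nat.le_of_add_right_le stride)
  have block' := block.congr h_same
  rw [Option.toList_none, List.append_nil]
  refine .next _ (block'.succ ?_) (fun j hj => block'.todo j (by rw [Fin.val_succ] at hj; omega)) ?_
  · rw [h_same.1, headPos, h_quot, block'.length_eq]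
    rwa [zero_add] at headRun
  · rw [Fin.val_succ, sweepsBeforeHead_succ]; omega

theorem SimInv.step {d e : M.sim.Cfg} (h : SimInv M x m d.state d.inPos d.word)
    (h_step : M.sim.Step x d e) : SimInv M x (m + 1) e.state e.inPos e.word := by
  obtain ⟨r, p, w⟩ := d
  obtain ⟨r', p', w''⟩ := e
  obtain ⟨-, a, mv, a', w', o, h_start, hs, hf, rfl⟩ := h_step
  have h_idle {r₀ p₀} (h : SimInv M x (m + 1) r₀ p₀ w)
      (hs : M.sim.Sweep x (.idle r₀) p₀ w a' p' w') :
      SimInv M x (m + 1) r' p' (w' ++ o.toList) := by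
    obtain ⟨rfl, rfl, rfl⟩ := sweep_idle_iff.1 hs
    cases hf
    rwa [Option.toList_none, List.append_nil]
  generalize h_read : inputCell x p = s at h_start
  cases h_start with
  | count hp => exact h.count (inputCell_ne_rightEnd_iff.1 (h_read ▸ hp)) hs hf
  | counted => exact h_idle (h.counted (inputCell_eq_rightEnd_iff.1 h_read)) hs
  | rewind hp => exact h_idle (h.rewind_left (inputCell_eq_leftEnd_iff.not.1 (h_read ▸ hp))) hs
  | rewound => obtain rfl := inputCell_eq_leftEnd_iff.1 h_read; exact h_idle h.rewound hs
  | accept => exact h_idle h.accept hs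
  | guess hq => exact h.guess hq hs hf
  | nextHead => exact h_idle h.nextHead hs
  | nextBlock => exact h_idle h.nextBlock hs
  | seek => exact h.seek_stride hs hf
  | seekMarks => exact h.seek_marks hs hf
  | verify => exact h.verified hs hf
  | back => exact h.back_stride hs hf
  | backMarks => exact h.back_marks hs hf

theorem simInv_of_reaches {m : ℕ} {d : M.sim.Cfg} (h : ReachesIn (M.sim.Step x) m M.sim.init d) :
    SimInv M x m d.state d.inPos d.word :=
  h.invariant (I := fun m d => SimInv M x m d.state d.inPos d.word)
    (.setup (p := 0) (w := []) (fun _ => ⟨rfl, rfl⟩) Nat.size_zero.symm rfl (Nat.zero_le _))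
    fun _ _ _ h hs => h.step hs

end Invariant

/-! ### Accepting paths are simulated -/

section Completeness

open Relation (ReflTransGen)

variable [Finite α] {x : List α}

theorem eq_false_of_lt {c : Bool} {u v n : ℕ} (h : u = v + n * c.toNat) (hu : u < v + n) :
    c = false := by
  cases c
  · rfl
  · rw [Bool.toNat_true, mul_one] at h
    exact absurd h hu.ne

theorem sim_step {r r' : M.Control} {p p' : ℕ} {w w' : List (Cell k α)} {a a' : M.Task}
    {mv : HeadMove} (hr : r ≠ .acc) (h_start : M.SimStart r (inputCell x p) a mv)
    (hs : M.sim.Sweep x a (mv.onInput x.length p) w a' p' w')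
    (hf : M.SimFinish a' (inputCell x p') r' none) :
    M.sim.Step x ⟨r, p, w⟩ ⟨r', p', w'⟩ :=
  ⟨hr, a, mv, a', w', none, h_start, hs, hf, (List.append_nil w').symm⟩

theorem sim_step_idle {r r' : M.Control} {p p' : ℕ} {w : List (Cell k α)} {mv : HeadMove}
    (hr : r ≠ .acc) (h_start : M.SimStart r (inputCell x p) (.idle r') mv)
    (hp : p' = mv.onInput x.length p) : M.sim.Step x ⟨r, p, w⟩ ⟨r', p', w⟩ :=
  sim_step hr h_start (sweep_idle_iff.2 ⟨rfl, hp, rfl⟩) .idle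

theorem reaches_verify (i : Fin k) (q : M.Q) {p P : ℕ} {w : List (Cell k α)}
    (hP : p + headPos i w = P) (hle : P ≤ x.length + 1) :
    ∃ w', ReflTransGen (M.sim.Step x) ⟨.seek i q, p, w⟩ ⟨.verify i q, P, w'⟩ ∧
      SameOff i w w' ∧ headQuot i w' = 0 := by
  generalize hv : headQuot i w = v
  induction v generalizing p w with
  | zero =>
    rw [headPos, hv, zero_mul, zero_add] at hP
    have hs : M.sim.Sweep x (.seekMarks i q) p w (.seekMarks i q) P w :=
      (sweep_seekMarks_iff (by omega)).2 ⟨rfl, rfl, hv, hP.symm, hle⟩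
    exact ⟨w, .single (sim_step nofun .seekMarks hs .seekMarks), .refl i w, hv⟩
  | succ v ih =>
    rw [headPos, hv, Nat.succ_mul] at hP
    obtain ⟨c', w', hs⟩ := exists_sweep_seek (M := M) (x := x) i true q (p := p) (w := w) (by omega)
    obtain ⟨_, ⟨⟩, -, -, h_same, h_rem, h_quot⟩ := sweep_seek hs (by omega)
    have h_lt := h_same.length_eq ▸ headQuot_lt i w'
    rw [hv, Bool.toNat_true] at h_quot
    obtain rfl := eq_false_of_lt h_quot (by omega)
    rw [Bool.toNat_false, mul_zero, add_zero] at h_quot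
    have hv' : headQuot i w' = v := by omega
    obtain ⟨w'', h_reach, h_same', h_zero⟩ := ih (p := p + w.length) (w := w')
      (by rw [headPos, hv', h_rem, h_same.length_eq]; omega) hv'
    exact ⟨w'', .head (sim_step nofun .seek hs .seek) h_reach, h_same.trans h_same', h_zero⟩

theorem reaches_next (i : Fin k) (q : M.Q) {p P : ℕ} {w : List (Cell k α)}
    (hw : w.length = blockLen x.length) (hP : headQuot i w * blockLen x.length + p = P)
    (hle : P ≤ x.length + 1) :
    ∃ w', ReflTransGen (M.sim.Step x) ⟨.back i q, p, w⟩ ⟨.next i.succ q, 0, w'⟩ ∧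
      SameOff i w w' ∧ headPos i w' = P := by
  have h_pos := blockLen_pos x.length
  induction p using Nat.strong_induction_on generalizing w with
  | _ p ih =>
    rcases le_or_gt p w.length with hp | hp
    · obtain ⟨w', hs⟩ := exists_sweep_backMarks (M := M) (x := x) i q 0 hp
      rw [zero_add] at hs
      obtain ⟨-, h_rem, h_same, h_quot⟩ := sweep_backMarks hs
      have h_end : inputCell x 0 = .leftEnd := inputCell_eq_leftEnd_iff.2 rfl
      refine ⟨w', .single (sim_step nofun .backMarks hs (h_end ▸ .backMarks)), h_same, ?_⟩
      rw [headPos, h_quot, h_same.length_eq, hw]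
      omega
    · obtain ⟨p', rfl⟩ := Nat.exists_eq_add_of_le' hp.le
      obtain ⟨c', w', hs⟩ := exists_sweep_back (M := M) (x := x) i true q p' w
      obtain ⟨_, ⟨⟩, -, h_same, -, h_quot⟩ := sweep_back hs
      have h_lt : x.length + 1 < 2 ^ w.length := hw ▸ Nat.lt_size_self _
      have h_le : headQuot i w ≤ headQuot i w * blockLen x.length := Nat.le_mul_of_pos_right _ h_pos
      rw [Bool.toNat_true] at h_quot
      obtain rfl := eq_false_of_lt h_quot (by omega)
      rw [Bool.toNat_false, mul_zero, add_zero] at h_quot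
      obtain ⟨w'', h_reach, h_same', h_head⟩ := ih p' (by omega) (w := w')
        (h_same.length_eq.trans hw) (by rw [← h_quot, ← hP, ← hw]; ring)
      exact ⟨w'', .head (sim_step nofun .back hs .back) h_reach, h_same.trans h_same', h_head⟩

theorem reaches_next_of_headRun (i : Fin k) (q : M.Q) {P : ℕ} {w : List (Cell k α)}
    (hw : w.length = blockLen x.length) (hle : headPos i w ≤ x.length + 1)
    (h_run : HeadRun x i (headPos i w) (records w) P) :
    ∃ w', ReflTransGen (M.sim.Step x) ⟨.next i.castSucc q, 0, w⟩ ⟨.next i.succ q, 0, w'⟩ ∧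
      SameOff i w w' ∧ headPos i w' = P := by
  have h_seek : M.sim.Step x ⟨.next i.castSucc q, 0, w⟩ ⟨.seek i q, 0, w⟩ :=
    sim_step_idle nofun (.nextHead i q) rfl
  obtain ⟨w₁, h_verify, h_same₁, h_zero⟩ := reaches_verify (M := M) i q (zero_add _) hle
  have hs : M.sim.Sweep x (.verify i q) (headPos i w) w₁ (.verify i q) P w₁ :=
    sweep_verify_iff.2 ⟨rfl, rfl, h_same₁.1 ▸ h_run⟩
  have h_back : M.sim.Step x ⟨.verify i q, headPos i w, w₁⟩ ⟨.back i q, P, w₁⟩ :=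
    sim_step nofun .verify hs .verify
  obtain ⟨w₂, h_next, h_same₂, h_head⟩ := reaches_next (M := M) i q (h_same₁.length_eq.trans hw)
    (by rw [h_zero, zero_mul, zero_add]) (h_run.le hle)
  exact ⟨w₂, .head h_seek ((h_verify.tail h_back).trans h_next), h_same₁.trans h_same₂, h_head⟩

theorem reaches_next_of_forall_headRun (q : M.Q) {P : Fin k → ℕ} {w : List (Cell k α)}
    (hw : w.length = blockLen x.length) (hle : ∀ i, headPos i w ≤ x.length + 1)
    (h_run : ∀ i, HeadRun x i (headPos i w) (records w) (P i)) (i : Fin (k + 1)) :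
    ∃ w', ReflTransGen (M.sim.Step x) ⟨.next 0 q, 0, w⟩ ⟨.next i q, 0, w'⟩ ∧
      records w' = records w ∧ (∀ j : Fin k, j.castSucc < i → headPos j w' = P j) ∧
      ∀ j : Fin k, i ≤ j.castSucc → headPos j w' = headPos j w := by
  induction i using Fin.induction with
  | zero => exact ⟨w, .refl, rfl, fun j hj => absurd hj (Fin.not_lt_zero _), fun _ _ => rfl⟩
  | succ i ih =>
    obtain ⟨w₁, h_reach₁, h_rec, h_done, h_todo⟩ := ih
    have hw₁ : w₁.length = blockLen x.length := by
      rw [← hw]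
      simpa [records] using congrArg List.length h_rec
    have hi := h_todo i le_rfl
    obtain ⟨w₂, h_reach₂, h_same, h_head⟩ := reaches_next_of_headRun (M := M) i q hw₁
      (hi ▸ hle i) (by rw [hi, h_rec]; exact h_run i)
    refine ⟨w₂, h_reach₁.trans h_reach₂, h_same.1.trans h_rec, fun j hj => ?_, fun j hj => ?_⟩
    · rcases (Fin.castSucc_lt_succ_iff.1 hj).eq_or_lt with rfl | hlt
      · exact h_head
      · exact (h_same.headPos_eq hlt.ne).trans (h_done j (Fin.castSucc_lt_castSucc_iff.2 hlt))
    · have hlt : i < j := Fin.succ_le_castSucc_iff.1 hj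
      exact (h_same.headPos_eq hlt.ne').trans (h_todo j (Fin.castSucc_le_castSucc_iff.2 hlt.le))

theorem reaches_main_of_runs {q q' : M.Q} (hq : q ≠ M.qacc) {P : Fin k → ℕ} {w : List (Cell k α)}
    {l : List (Option (Record k α))} (hw : w.length = blockLen x.length)
    (hl : l.length = blockLen x.length) (hle : ∀ i, headPos i w ≤ x.length + 1)
    (h_run : StateRun M q l q') (h_runs : ∀ i, HeadRun x i (headPos i w) l (P i)) :
    ∃ w', ReflTransGen (M.sim.Step x) ⟨.main q, 0, w⟩ ⟨.main q', 0, w'⟩ ∧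
      w'.length = blockLen x.length ∧ ∀ i, headPos i w' = P i := by
  obtain ⟨w₁, hs, rfl, h_track⟩ := exists_sweep_guess (x := x) h_run 0 (hl.trans hw.symm)
  have h_pos i : headPos i w₁ = headPos i w := headPos_congr (h_track i)
  obtain ⟨w₂, h_reach, h_rec, h_done, -⟩ := reaches_next_of_forall_headRun (M := M) q'
    (hs.length_eq.trans hw) (fun i => h_pos i ▸ hle i) (fun i => h_pos i ▸ h_runs i) (Fin.last k)
  have h_guess : M.sim.Step x ⟨.main q, 0, w⟩ ⟨.next 0 q', 0, w₁⟩ :=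
    sim_step nofun (.guess hq) hs .guess
  have h_main : M.sim.Step x ⟨.next (Fin.last k) q', 0, w₂⟩ ⟨.main q', 0, w₂⟩ :=
    sim_step_idle nofun .nextBlock rfl
  refine ⟨w₂, .head h_guess (h_reach.tail h_main), ?_, fun i => h_done i (Fin.castSucc_lt_last i)⟩
  rw [← hl, ← h_rec, records, List.length_map]

theorem reaches_acc {t : ℕ} {c d : M.Cfg} {w : List (Cell k α)}
    (hw : w.length = blockLen x.length) (hc : ∀ i, headPos i w = c.pos i)
    (hle : ∀ i, c.pos i ≤ x.length + 1) (h : ReachesIn (M.Step x) t c d)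
    (hd : d.state = M.qacc) :
    ∃ w', ReflTransGen (M.sim.Step x) ⟨.main c.state, 0, w⟩ ⟨.acc, 0, w'⟩ := by
  induction t using Nat.strong_induction_on generalizing c w with
  | _ t ih =>
    have h_pos := blockLen_pos x.length
    by_cases hq : c.state = M.qacc
    · rw [hq]
      exact ⟨w, .single (sim_step_idle nofun .accept rfl)⟩
    have ht : t ≠ 0 := by
      rintro rfl
      cases h
      exact hq hd
    obtain ⟨s, r, e, h_sum, hs, hr, hsb, h_end⟩ : ∃ s r e, s + r = t ∧
        ReachesIn (M.Step x) s c e ∧ ReachesIn (M.Step x) r e d ∧ s ≤ blockLen x.length ∧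
        (s = blockLen x.length ∨ e = d ∧ r = 0) := by
      rcases le_total t (blockLen x.length) with htb | htb
      · exact ⟨t, 0, d, rfl, h, .refl d, htb, .inr ⟨rfl, rfl⟩⟩
      · obtain ⟨r, rfl⟩ := Nat.exists_eq_add_of_le htb
        obtain ⟨e, hs, hr⟩ := h.split
        exact ⟨_, r, e, rfl, hs, hr, le_rfl, .inl rfl⟩
    obtain ⟨l, hl, h_run, h_runs⟩ := exists_runs_of_reaches hs hsb
      (h_end.imp_right fun ⟨h_eq, _⟩ => h_eq ▸ hd)
    simp only [← hc] at h_runs hle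
    obtain ⟨w', h_block, hw', h_head⟩ := reaches_main_of_runs hq hw hl hle h_run h_runs
    obtain ⟨w'', h_rest⟩ := ih r (by omega) hw' h_head (fun i => (h_runs i).le (hle i)) hr
    exact ⟨w'', h_block.trans h_rest⟩

theorem reaches_setup {p : ℕ} (hp : p ≤ x.length + 1) :
    ∃ w, ReflTransGen (M.sim.Step x) M.sim.init ⟨.setup, p, w⟩ := by
  induction p with
  | zero => exact ⟨[], .refl⟩
  | succ p ih =>
    obtain ⟨w, h⟩ := ih (Nat.le_of_succ_le hp)
    have hp' : p ≤ x.length := Nat.le_of_succ_le_succ hp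
    have h_start : M.SimStart .setup (inputCell x p) (.count true) .right :=
      .count (inputCell_ne_rightEnd_iff.2 hp')
    obtain ⟨c, w', hs⟩ := exists_sweep_count (M := M) (x := x) true (p + 1) w
    rw [← HeadMove.onInput_right hp'] at hs ⊢
    cases c with
    | false => exact ⟨w', h.tail (sim_step nofun h_start hs .count)⟩
    | true => exact ⟨_, h.tail ⟨nofun, _, _, _, _, _, h_start, hs, .extend, rfl⟩⟩

theorem reaches_main (p : ℕ) (w : List (Cell k α)) :
    ReflTransGen (M.sim.Step x) ⟨.rewind, p, w⟩ ⟨.main M.q₀, 0, w⟩ := by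
  induction p with
  | zero =>
    have h_read : inputCell x 0 = .leftEnd := inputCell_eq_leftEnd_iff.2 rfl
    have h_start : M.SimStart .rewind (inputCell x 0) (.idle (.main M.q₀)) .stay :=
      h_read ▸ .rewound
    exact .single (sim_step_idle nofun h_start rfl)
  | succ p ih =>
    have h_read : inputCell x (p + 1) ≠ .leftEnd := inputCell_eq_leftEnd_iff.not.2 p.succ_ne_zero
    exact .head (sim_step_idle nofun (.rewind h_read) rfl) ih

theorem sim_accepts_of_accepts (h : M.Accepts x) : M.sim.Accepts x := by
  obtain ⟨t, d, h_path, hd⟩ := h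
  obtain ⟨w, h_setup⟩ := reaches_setup (M := M) (x := x) le_rfl
  have h_read : inputCell x (x.length + 1) = .rightEnd :=
    inputCell_eq_rightEnd_iff.2 (Nat.lt_succ_self _)
  have h_start : M.SimStart .setup (inputCell x (x.length + 1)) (.idle .rewind) .stay :=
    h_read ▸ .counted
  have h_counted : M.sim.Step x ⟨.setup, x.length + 1, w⟩ ⟨.rewind, x.length + 1, w⟩ :=
    sim_step_idle nofun h_start rfl
  obtain ⟨m, hm⟩ := ReachesIn.exists_iff_reflTransGen.2 h_setup
  cases simInv_of_reaches hm with | setup fresh length_eq => ?_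
  obtain ⟨w', h_acc⟩ := reaches_acc (M := M) (c := M.init) length_eq fresh.headPos_eq_zero
    (fun _ => Nat.zero_le _) h_path hd
  obtain ⟨m', hm'⟩ := ReachesIn.exists_iff_reflTransGen.2
    (((h_setup.tail h_counted).trans (reaches_main _ _)).trans h_acc)
  exact ⟨m', _, hm', rfl⟩

theorem accepts_of_sim_accepts (h : M.sim.Accepts x) : M.Accepts x := by
  obtain ⟨m, ⟨r, p, w⟩, hm, rfl : r = .acc⟩ := h
  cases simInv_of_reaches hm with
  | acc _ reach accepting => exact ⟨_, _, reach, accepting⟩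

variable (M) in
theorem sim_toNTM_language : M.sim.toNTM.language = M.language :=
  Set.ext fun _ => Sweeper.toNTM_accepts_iff.trans ⟨accepts_of_sim_accepts, sim_accepts_of_accepts⟩

theorem sim_length_le (x : List α) (m : ℕ) (d : M.sim.Cfg)
    (h : ReachesIn (M.sim.Step x) m M.sim.init d) : d.word.length ≤ blockLen x.length :=
  (simInv_of_reaches h).length_le

theorem RunsInTime.sim_sweeps_le {T : ℕ → ℕ} (hT : M.RunsInTime T) (x : List α) (m : ℕ)
    (d : M.sim.Cfg) (h : ReachesIn (M.sim.Step x) m M.sim.init d) :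
    m ≤ sweepsBefore k x.length (T x.length / blockLen x.length + 1) + 1 := by
  obtain ⟨t, c, B, h_path, h_block, hm⟩ := (simInv_of_reaches h).accountsFor
  have hB : B ≤ T x.length / blockLen x.length + 1 := by
    rw [← Nat.add_div_right _ (blockLen_pos _), Nat.le_div_iff_mul_le (blockLen_pos _)]
    exact h_block.trans (Nat.add_le_add_right (hT x t c h_path) _)
  exact hm.trans (Nat.succ_le_succ (sweepsBefore_mono hB))

end Completeness
/-! ### The resource bounds -/

section Asymptotics

open Asymptotics Filter Real

theorem log_le_blockLen (n : ℕ) : log n ≤ blockLen n := by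
  rcases Nat.eq_zero_or_pos n with rfl | hn
  · simp
  have h_pow : (n : ℝ) ≤ 2 ^ blockLen n := by
    exact_mod_cast n.le_succ.trans (Nat.lt_size_self (n + 1)).le
  calc log n ≤ log (2 ^ blockLen n) := log_le_log (Nat.cast_pos.2 hn) h_pow
    _ = blockLen n * log 2 := log_pow _ _
    _ ≤ blockLen n := mul_le_of_le_one_right (Nat.cast_nonneg _)
      (log_two_lt_d9.le.trans (by norm_num))

theorem blockLen_le {n : ℕ} (hn : n ≠ 0) : (blockLen n : ℝ) ≤ 2 * log n + 2 := by
  have hn' : (1 : ℝ) ≤ n := Nat.one_le_cast.2 (Nat.one_le_iff_ne_zero.2 hn)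
  obtain ⟨l, hl⟩ := Nat.exists_eq_add_one.2 (blockLen_pos n)
  have h_pow : (2 : ℝ) ^ l ≤ 2 * n := by
    have : 2 ^ l ≤ n + 1 := Nat.lt_size.1 (l.lt_succ_self.trans_eq hl.symm)
    have : (2 : ℝ) ^ l ≤ n + 1 := by exact_mod_cast this
    linarith
  have h_log : l * log 2 ≤ log 2 + log n := by
    rw [← log_pow, ← log_mul two_ne_zero (by positivity)]
    exact log_le_log (by positivity) h_pow
  have h_half : (1 / 2 : ℝ) ≤ log 2 := by linarith [log_two_gt_d9]
  have h_nonneg := log_nonneg hn'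
  rw [hl, Nat.cast_succ]
  nlinarith

theorem eventually_log_natCast_pos : ∀ᶠ n : ℕ in atTop, 0 < log n :=
  (tendsto_log_atTop.comp tendsto_natCast_atTop_atTop).eventually_gt_atTop 0

theorem one_isBigO_log : (fun _ => 1 : ℕ → ℝ) =O[atTop] fun n => log n :=
  (isLittleO_const_log_atTop.comp_tendsto tendsto_natCast_atTop_atTop).isBigO

theorem blockLen_isBigO_log : (fun n => (blockLen n : ℝ)) =O[atTop] fun n => log n := by
  refine IsBigO.trans (.of_norm_eventuallyLE ?_)
    (((isBigO_refl _ _).const_mul_left 2).add (one_isBigO_log.const_mul_left 2))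
  filter_upwards [eventually_ne_atTop 0] with n hn
  simpa using blockLen_le hn

theorem div_blockLen_isBigO {T : ℕ → ℕ} {f : ℕ → ℝ} (hT : (fun n => (T n : ℝ)) =O[atTop] f) :
    (fun n => ((T n / blockLen n : ℕ) : ℝ)) =O[atTop] fun n => f n / log n := by
  refine IsBigO.trans (.of_norm_eventuallyLE ?_)
    (hT.mul (isBigO_refl (fun n : ℕ => (log n)⁻¹) atTop))
  filter_upwards [eventually_log_natCast_pos] with n hn
  rw [norm_of_nonneg (Nat.cast_nonneg _), ← div_eq_mul_inv]
  exact Nat.cast_div_le.trans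
    (div_le_div_of_nonneg_left (Nat.cast_nonneg _) hn (log_le_blockLen n))

theorem one_isBigO_natCast_div_log :
    (fun _ => 1 : ℕ → ℝ) =O[atTop] fun n => n / log n := by
  refine .of_norm_eventuallyLE ?_
  filter_upwards [eventually_log_natCast_pos] with n hn
  rw [norm_one, one_le_div hn]
  exact log_le_self n.cast_nonneg

theorem headCost_isBigO : (fun n => (headCost n : ℝ)) =O[atTop] fun n => n / log n := by
  have h_succ : (fun n => ((n + 1 : ℕ) : ℝ)) =O[atTop] fun n => (n : ℝ) := by
    simpa using (isBigO_refl _ _).add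
      ((isLittleO_const_id_atTop (1 : ℝ)).comp_tendsto tendsto_natCast_atTop_atTop).isBigO
  refine (((div_blockLen_isBigO h_succ).const_mul_left 2).add
    (one_isBigO_natCast_div_log.const_mul_left 4)).congr_left fun n => ?_
  simp [headCost, strides]

theorem log_isBigO_div_log {f : ℕ → ℝ} (hf : (fun n : ℕ => log n ^ 2) =O[atTop] f) :
    (fun n : ℕ => log n) =O[atTop] fun n => f n / log n := by
  refine (hf.mul (isBigO_refl (fun n : ℕ => (log n)⁻¹) atTop)).congr' ?_ .rfl
  filter_upwards [eventually_log_natCast_pos] with n hn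
  field_simp

theorem sweepsBefore_isBigO (k : ℕ) {T : ℕ → ℕ} {f : ℕ → ℝ}
    (hf : (fun n : ℕ => log n ^ 2) =O[atTop] f) (hT : (fun n => (T n : ℝ)) =O[atTop] f) :
    (fun n => (sweepsBefore k n (T n / blockLen n + 1) : ℝ)) =O[atTop]
      fun n => n / log n * (f n / log n) := by
  have h_log := log_isBigO_div_log hf
  have h_one := one_isBigO_log.trans h_log
  have h_id : (fun n : ℕ => (n : ℝ)) =O[atTop] fun n => n / log n * (f n / log n) := by
    refine ((isBigO_refl (fun n : ℕ => n / log n) atTop).mul h_log).congr' ?_ .rfl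
    filter_upwards [eventually_log_natCast_pos] with n hn
    field_simp
  have h_init := (h_id.const_mul_left 2).add
    ((one_isBigO_natCast_div_log.mul h_one).const_mul_left 4)
  have h_block := (headCost_isBigO.const_mul_left k).add
    (one_isBigO_natCast_div_log.const_mul_left 2)
  refine (h_init.add (h_block.mul ((div_blockLen_isBigO hT).add h_one))).congr_left fun n => ?_
  simp only [sweepsBefore]
  push_cast
  ring

theorem sim_time_isBigO (k : ℕ) {T : ℕ → ℕ} {f : ℕ → ℝ}
    (hf : (fun n : ℕ => log n ^ 2) =O[atTop] f) (hT : (fun n => (T n : ℝ)) =O[atTop] f) :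
    (fun n => (((sweepsBefore k n (T n / blockLen n + 1) + 1 + 1) * (2 * blockLen n + 2) + 1 : ℕ) :
      ℝ)) =O[atTop] fun n => n * f n / log n := by
  have h_one := one_isBigO_natCast_div_log.mul (one_isBigO_log.trans (log_isBigO_div_log hf))
  have h_sweeps := (sweepsBefore_isBigO k hf hT).add (h_one.const_mul_left 2)
  have h_len := (blockLen_isBigO_log.const_mul_left 2).add (one_isBigO_log.const_mul_left 2)
  refine ((h_sweeps.mul h_len).add (h_one.mul one_isBigO_log)).congr (fun n => ?_) fun n => ?_
  · push_cast
    ring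
  · rcases eq_or_ne (log n) 0 with h | h
    · simp [h]
    · field_simp

theorem sim_space_isBigO : (fun n => ((blockLen n + 2 : ℕ) : ℝ)) =O[atTop] fun n => log n := by
  simpa using blockLen_isBigO_log.add (one_isBigO_log.const_mul_left 2)

end Asymptotics

end TwoNFA

/-- The `log n ^ 2` comes from the time `O(n log n)` that counting the input length takes. -/
theorem mainTheorem2_general (α : Type) [Finite α] {f : ℕ → ℝ}
    (hf : (fun n : ℕ => Real.log n ^ 2) =O[Filter.atTop] f) :
    MultiheadNFATime α f ⊆ NTISP α (fun n => n * f n / Real.log n) (fun n => Real.log n) := by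
  rintro L ⟨k, -, M, T, rfl, hT, hTf⟩
  exact ⟨M.sim.toNTM, _, _, M.sim_toNTM_language,
    Sweeper.runsInTime_toNTM hT.sim_sweeps_le TwoNFA.sim_length_le,
    Sweeper.runsInSpace_toNTM TwoNFA.sim_length_le,
    TwoNFA.sim_time_isBigO k hf hTf, TwoNFA.sim_space_isBigO⟩

theorem mainTheorem2 (α : Type) [Finite α] :
    MultiheadNFATime α (fun n => (n : ℝ)) ⊆
      NTISP α (fun n => (n : ℝ) ^ 2 / Real.log n) (fun n => Real.log n) := by
  simpa only [pow_two] using mainTheorem2_general α (f := fun n => n)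
    (Real.isLittleO_pow_log_id_atTop.comp_tendsto tendsto_natCast_atTop_atTop).isBigO
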